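/- **Setting.** Fix $k$ and $n_x\ge 1$. The space of two-step trajectories is $T=[\{k\}\times\mathbb R^{n_x}]\uplus[\{k+1\}\times\mathbb R^{n_x}]\uplus[\{k\}\times\mathbb R^{2n_x}]$, with elements $(k,x_1)$, $(k+1,x_1)$, $(k,x_{1:2})$, and $\int\pi(X)\,dX$ denotes the sum of the Lebesgue integrals over the three pieces; the space $M$ of trajectory measurements is defined in the same way with $\mathbb R^{n_z}$. Write $\langle a,b\rangle=\int a(X)b(X)\,dX$ and $\int f(\mathbf X)\,\delta\mathbf X=\sum_{n\ge 0}\frac1{n!}\int f(\{X_1,\dots,X_n\})\,dX_{1:n}$ for functions $f$ of finite subsets of $T$; densities of random finite sets are identified when they agree almost everywhere on the sets of each cardinality. A Bernoulli density with parameters $(r,p)$ is $1-r$ at $\emptyset$, $r\,p(X)$ at $\{X\}$, and $0$ on larger sets. A PMBM density with $n$ Bernoulli components is $$f(\mathbf X)=\sum_{\mathbf Y\uplus\mathbf W=\mathbf X}e^{-\int\lambda}\prod_{Y\in\mathbf Y}\lambda(Y)\;\sum_{a\in\mathcal A}w^a\sum_{\uplus_{i=1}^n\mathbf X^i=\mathbf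 W}\ \prod_{i=1}^n f^{i,a^i}(\mathbf X^i),$$ where $\lambda\ge 0$ is integrable, $\mathcal A$ is a finite set of global hypotheses $a=(a^1,\dots,a^n)$ with $a^i\in\{1,\dots,h^i\}$, $w^a\ge 0$, $\sum_{a\in\mathcal A} w^a=1$, and $f^{i,a^i}$ is the Bernoulli density with existence probability $r^{i,a^i}\in[0,1]$ and single-trajectory probability density $p^{i,a^i}$. *Measurement model.* Given a set $\mathbf X$ of trajectories, the measurement set is the union of independent sets: a Poisson point process (clutter) with integrable intensity $\lambda^C$ on $M$, and, for each $X\in\mathbf X$, a set that with probability $p^D(X)\in[0,1]$ consists of one measurement with density $l(\cdot|X)$ and is otherwise empty. Here $l(Z|X)$ equals $\gamma h_{1,3}(z_1|x_{1:2})$ for $Z=(k,z_1)$, $X=(k,x_{1:2})$; $\gamma h_{2,3}(z_1|x_{1:2})$ for $Z=(k+1,z_1)$, $X=(k,x_{1:2})$; $\widetilde p^{D}h_{3,3}(z_{1:2}|x_{1:2})$ for $Z=(k,z_{1:2})$, $X=(k,x_{1:2})$; $h_{1,1}(z_1|x_1)$ for $Z=(k,z_1)$, $X=(k,x_1)$;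 $h_{2,2}(z_1|x_1)$ for $Z=(k+1,z_1)$, $X=(k+1,x_1)$; and $0$ otherwise, where $\widetilde p^D\in[0,1]$, $\gamma=\frac12(1-\widetilde p^D)$ and the $h_{\mu,\tau}$ are conditional probability densities. **Lemma (TM-PMBM update).** Let the predicted density of the set of trajectories be a PMBM density $f$ as above, with parameters $n,\lambda,h^i,r^{i,a},p^{i,a},\mathcal A,w^a$, and let $\mathbf Z=\{Z^1,\dots,Z^m\}\subset M$ (with $Z^1,\dots,Z^m$ distinct) be the observed set of measurements. Let $g(\mathbf Z|\mathbf X)$ be the density of the measurement set. Assume that the inner products $\langle p^{i,a},l(Z^j|\cdot)p^D\rangle$ and $\langle\lambda,l(Z^j|\cdot)p^D\rangle$ are finite and that $\int g(\mathbf Z|\mathbf X)f(\mathbf X)\,\delta\mathbf X\ne 0$. Then this set integral converges, and the posterior density $\mathbf X\mapsto g(\mathbf Z|\mathbf X)f(\mathbf X)/\int g(\mathbf Z|\mathbf X')f(\mathbf X')\,\delta\mathbf X'$ is exactly a PMBM density with $n+m$ Bernoulli components, Poisson intensity $$\lambda_{+}(X)=(1-p^D(X))\,\lambda(X),$$ and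 the following local hypotheses, with local weights $w_+^{i,a}$, existence probabilities $r_+^{i,a}$ and densities $p_+^{i,a}$. (A ratio $0/0$ in an existence probability is read as $0$. A density whose denominator vanishes is an arbitrary probability density; the hypothesis then has local weight $0$ or existence probability $0$.) * Existing components $i\in\{1,\dots,n\}$ have $h^i(m+1)$ local hypotheses. For $a\in\{1,\dots,h^i\}$, the missed detection hypothesis has index $a$ and $$w_+^{i,a}=1-r^{i,a}\langle p^{i,a},p^D\rangle,\quad r_+^{i,a}=\frac{r^{i,a}\langle p^{i,a},1-p^D\rangle}{1-r^{i,a}\langle p^{i,a},p^D\rangle},\quad p_+^{i,a}(X)=\frac{(1-p^D(X))\,p^{i,a}(X)}{\langle p^{i,a},1-p^D\rangle}.$$ For $\widetilde a\in\{1,\dots,h^i\}$ and $j\in\{1,\dots,m\}$, the hypothesis of detection by $Z^j$ has index $a=\widetilde a+h^i j$ and $$r_+^{i,a}=1,\quad w_+^{i,a}=r^{i,\widetilde a}\langle p^{i,\widetilde a},l(Z^j|\cdot)p^D\rangle,\quad p_+^{i,a}(X)=\frac{l(Z^j|X)\,p^D(X)\,p^{i,\widetilde a}(X)}{\langle p^{i,\widetilde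 a},l(Z^j|\cdot)p^D\rangle}.$$ * The new component $i=n+j$, $j\in\{1,\dots,m\}$, has two local hypotheses: missed detection, with $w_+^{i,1}=1$ and $r_+^{i,1}=0$, and detection, with $$w_+^{i,2}=\lambda^C(Z^j)+\langle\lambda,l(Z^j|\cdot)p^D\rangle,\quad r_+^{i,2}=\frac{\langle\lambda,l(Z^j|\cdot)p^D\rangle}{\lambda^C(Z^j)+\langle\lambda,l(Z^j|\cdot)p^D\rangle},\quad p_+^{i,2}(X)=\frac{l(Z^j|X)\,p^D(X)\,\lambda(X)}{\langle\lambda,l(Z^j|\cdot)p^D\rangle}.$$ * The global hypotheses are those $b=b(a,\sigma)$ that arise from some $a\in\mathcal A$ and some map $\sigma:\{1,\dots,n\}\to\{0,1,\dots,m\}$ that takes no nonzero value twice: $b^i=a^i+h^i\sigma(i)$ for $i\le n$, and $b^{n+j}=1$ if $j$ is a value of $\sigma$, $b^{n+j}=2$ otherwise. Their weights are $$w_+^{b(a,\sigma)}=\frac{w^a\prod_{i=1}^{n+m}w_+^{i,b(a,\sigma)^i}}{\sum_{a'\in\mathcal A}\sum_{\sigma'}w^{a'}\prod_{i=1}^{n+m}w_+^{i,b(a',\sigma')^i}}.$$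 -/

import Mathlib

open MeasureTheory

noncomputable section

/-! ### Densities of random finite sets on a measured space -/

section FiniteSets

variable {S : Type*}

/-- All labelled decompositions `⊎_{i} P i = X` of the finite set `X` into mutually disjoint,
possibly empty, subsets `P i`. -/
def decompositions (ι : Type*) [Fintype ι] (X : Finset S) : Finset (ι → Finset S) := by
  classical
  exact {P ∈ Fintype.piFinset (fun _ : ι => X.powerset) |
    (∀ i i', i ≠ i' → Disjoint (P i) (P i')) ∧ Finset.univ.biUnion P = X}

/-- Density of the union of independent random finite sets with densities `f i`:
`∑_{⊎ X^i = X} ∏ i, f i (X^i)`. -/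
def unionDensity {ι : Type*} [Fintype ι] (f : ι → Finset S → ℝ) (X : Finset S) : ℝ :=
  ∑ P ∈ decompositions ι X, ∏ i, f i (P i)

/-- Bernoulli density: `1 - r` at `∅`, `r * p x` at `{x}`, and `0` at larger sets. -/
def bernoulliDensity (r : ℝ) (p : S → ℝ) (X : Finset S) : ℝ :=
  if X.card = 0 then 1 - r else if X.card = 1 then r * ∏ x ∈ X, p x else 0

variable [MeasurableSpace S]

/-- Density of the Poisson point process with intensity `lam`. -/
def poissonDensity (μ : Measure S) (lam : S → ℝ) (X : Finset S) : ℝ :=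
  Real.exp (-∫ x, lam x ∂μ) * ∏ x ∈ X, lam x

/-- The density of the union of a Poisson point process with intensity `lam` and an independent
random finite set with density `f`. -/
def poissonUnionDensity (μ : Measure S) (lam : S → ℝ) (f : Finset S → ℝ) (X : Finset S) : ℝ := by
  classical
  exact ∑ Y ∈ X.powerset, poissonDensity μ lam Y * f (X \ Y)

/-- The finite set `{x_1, …, x_n}`. -/
def toFiniteSet {n : ℕ} (x : Fin n → S) : Finset S := by
  classical
  exact Finset.univ.image x

/-- The `n`-th term `(1 / n!) ∫ f({x_1, …, x_n}) dx_{1:n}` of the set integral. -/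
def setIntegralTerm (μ : Measure S) (f : Finset S → ℝ) (n : ℕ) : ℝ :=
  1 / (n.factorial : ℝ) * ∫ x : Fin n → S, f (toFiniteSet x) ∂(Measure.pi fun _ => μ)

/-- The set integral `∫ f(X) δX = ∑_n (1 / n!) ∫ f({x_1, …, x_n}) dx_{1:n}`. -/
def setIntegral (μ : Measure S) (f : Finset S → ℝ) : ℝ :=
  ∑' n : ℕ, setIntegralTerm μ f n

/-- All integrals and the series in the set integral of `f` converge. -/
def SetIntegrable (μ : Measure S) (f : Finset S → ℝ) : Prop :=
  (∀ n : ℕ, Integrable (fun x : Fin n → S => f (toFiniteSet x)) (Measure.pi fun _ => μ)) ∧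
    Summable (setIntegralTerm μ f)

/-- Equality of two functions of finite sets as densities, i.e. almost everywhere on the sets of
each cardinality. -/
def DensityEq (μ : Measure S) (f g : Finset S → ℝ) : Prop :=
  ∀ n : ℕ, ∀ᵐ x : Fin n → S ∂(Measure.pi fun _ => μ), f (toFiniteSet x) = g (toFiniteSet x)

/-- Bayes' rule for random finite sets: the posterior density for the prior density `f` and the
likelihood `L` (of the observed data, as a function of the unknown set). -/
def bayesPosterior (μ : Measure S) (L f : Finset S → ℝ) (X : Finset S) : ℝ :=
  L X * f X / setIntegral μ (fun Y => L Y * f Y)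

/-- The inner product `⟨a, b⟩ = ∫ a(x) b(x) dx`. -/
def innerProd (μ : Measure S) (a b : S → ℝ) : ℝ := ∫ x, a x * b x ∂μ

/-- Probability densities on `S`. -/
structure IsProbDensity (μ : Measure S) (p : S → ℝ) : Prop where
  measurable : Measurable p
  nonneg : ∀ x, 0 ≤ p x
  integral_eq_one : ∫ x, p x ∂μ = 1

/-- Intensities of finite Poisson point processes on `S`. -/
structure IsIntensity (μ : Measure S) (lam : S → ℝ) : Prop where
  measurable : Measurable lam
  nonneg : ∀ x, 0 ≤ lam x
  integrable : Integrable lam μ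

/-- The parameters of a Poisson multi-Bernoulli mixture with `n` Bernoulli components (potential
objects). Component `i` has local hypotheses `1, …, h i`; a global hypothesis selects one local
hypothesis for each component. -/
structure PMBM (μ : Measure S) (n : ℕ) where
  /-- Poisson intensity -/
  intensity : S → ℝ
  /-- numbers of local hypotheses -/
  h : Fin n → ℕ
  /-- existence probabilities -/
  r : Fin n → ℕ → ℝ
  /-- single-object densities -/
  p : Fin n → ℕ → S → ℝ
  /-- the set of global hypotheses -/
  hyps : Finset (Fin n → ℕ)
  /-- weights of the global hypotheses -/
  w : (Fin n → ℕ) → ℝ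
  isIntensity : IsIntensity μ intensity
  r_mem : ∀ i, ∀ a ∈ Finset.Icc 1 (h i), 0 ≤ r i a ∧ r i a ≤ 1
  isProbDensity : ∀ i, ∀ a ∈ Finset.Icc 1 (h i), IsProbDensity μ (p i a)
  hyps_mem : ∀ a ∈ hyps, ∀ i, a i ∈ Finset.Icc 1 (h i)
  w_nonneg : ∀ a ∈ hyps, 0 ≤ w a
  w_sum : ∑ a ∈ hyps, w a = 1

/-- The multi-Bernoulli mixture part of the density. -/
def PMBM.mbmDensity {μ : Measure S} {n : ℕ} (P : PMBM μ n) (X : Finset S) : ℝ :=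
  ∑ a ∈ P.hyps, P.w a * unionDensity (fun i => bernoulliDensity (P.r i (a i)) (P.p i (a i))) X

/-- The PMBM density `∑_{X ⊎ Y} f^p(Y) f^mbm(X)`. -/
def PMBM.density {μ : Measure S} {n : ℕ} (P : PMBM μ n) : Finset S → ℝ :=
  poissonUnionDensity μ P.intensity P.mbmDensity

end FiniteSets

/-! ### Two-step trajectories and trajectory measurements -/

/-- The space `[{k} × ℝ^d] ⊎ [{k+1} × ℝ^d] ⊎ [{k} × ℝ^{2d}]` of two-step trajectories (or of
trajectory measurements). The start time is determined by the summand: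
`inl x` is `(k, x)`, `inr (inl x)` is `(k+1, x)`, `inr (inr (x₁, x₂))` is `(k, x_{1:2})`. -/
abbrev TwoStep (d : ℕ) : Type :=
  (Fin d → ℝ) ⊕ ((Fin d → ℝ) ⊕ ((Fin d → ℝ) × (Fin d → ℝ)))

/-- The reference measure of the trajectory integral: Lebesgue measure on each of the three
pieces. -/
def trajMeasure (d : ℕ) : Measure (TwoStep d) :=
  Measure.map (fun x : Fin d → ℝ => (Sum.inl x : TwoStep d)) volume +
  Measure.map (fun x : Fin d → ℝ => (Sum.inr (Sum.inl x) : TwoStep d)) volume +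
  Measure.map (fun x : (Fin d → ℝ) × (Fin d → ℝ) => (Sum.inr (Sum.inr x) : TwoStep d)) volume

/-- `h z x = h(z | x)` is a conditional probability density. -/
structure IsCondDensity {A B : Type*} [MeasureSpace A] [MeasurableSpace B] (h : A → B → ℝ) :
    Prop where
  measurable : Measurable (fun q : A × B => h q.1 q.2)
  nonneg : ∀ z x, 0 ≤ h z x
  integral_eq_one : ∀ x, ∫ z, h z x = 1

/-- Parameters of the trajectory-measurement model. -/
structure TrajMeasModel (nx nz : ℕ) where
  /-- probability of detection of a two-step trajectory -/
  pD : TwoStep nx → ℝ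
  /-- probability of a full measurement, given that a trajectory present at both times
  is detected -/
  pFull : ℝ
  h11 : (Fin nz → ℝ) → (Fin nx → ℝ) → ℝ
  h22 : (Fin nz → ℝ) → (Fin nx → ℝ) → ℝ
  h13 : (Fin nz → ℝ) → (Fin nx → ℝ) × (Fin nx → ℝ) → ℝ
  h23 : (Fin nz → ℝ) → (Fin nx → ℝ) × (Fin nx → ℝ) → ℝ
  h33 : (Fin nz → ℝ) × (Fin nz → ℝ) → (Fin nx → ℝ) × (Fin nx → ℝ) → ℝ
  /-- clutter intensity -/
  lamC : TwoStep nz → ℝ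
  pD_measurable : Measurable pD
  pD_mem : ∀ X, 0 ≤ pD X ∧ pD X ≤ 1
  pFull_mem : 0 ≤ pFull ∧ pFull ≤ 1
  h11_density : IsCondDensity h11
  h22_density : IsCondDensity h22
  h13_density : IsCondDensity h13
  h23_density : IsCondDensity h23
  h33_density : IsCondDensity h33
  lamC_intensity : IsIntensity (trajMeasure nz) lamC

namespace TrajMeasModel

variable {nx nz : ℕ} (M : TrajMeasModel nx nz)

/-- `γ = 0.5 (1 - p̃^D)`. -/
def gam : ℝ := 1 / 2 * (1 - M.pFull)

/-- The single-trajectory measurement density `l(Z | X)`. -/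
def l : TwoStep nz → TwoStep nx → ℝ
  | Sum.inl z, Sum.inr (Sum.inr x) => M.gam * M.h13 z x
  | Sum.inr (Sum.inl z), Sum.inr (Sum.inr x) => M.gam * M.h23 z x
  | Sum.inr (Sum.inr z), Sum.inr (Sum.inr x) => M.pFull * M.h33 z x
  | Sum.inl z, Sum.inl x => M.h11 z x
  | Sum.inr (Sum.inl z), Sum.inr (Sum.inl x) => M.h22 z x
  | _, _ => 0

/-- The density of the set `Z` of trajectory measurements given the set `X` of trajectories: `Z` is
the union of Poisson clutter and, independently for each `x ∈ X`, a measurement set that has one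
element, with density `l(· | x)`, with probability `p^D(x)` and is empty otherwise. -/
def likelihood (Z : Finset (TwoStep nz)) (X : Finset (TwoStep nx)) : ℝ :=
  poissonUnionDensity (trajMeasure nz) M.lamC
    (unionDensity fun x : X => bernoulliDensity (M.pD x) (fun z => M.l z x)) Z

end TrajMeasModel

/-! ### Data association -/

/-- Associations of `n` existing components to `m` measurements: `σ i = 0` means that component
`i` is misdetected, `σ i = j` with `1 ≤ j ≤ m` that it generated the `j`-th measurement. No
measurement is assigned twice. -/
def associations (n m : ℕ) : Finset (Fin n → Fin (m + 1)) := by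
  classical
  exact {σ | ∀ i i', σ i = σ i' → σ i ≠ 0 → i = i'}

/-- The updated global hypothesis obtained from the predicted global hypothesis `a` and the
association `σ`: component `i ≤ n` gets index `a^i + h^i σ(i)`; the new component of a measurement
gets index `1` if the measurement is assigned to an existing component, and `2` otherwise. -/
def updatedHyp {n m : ℕ} (h a : Fin n → ℕ) (σ : Fin n → Fin (m + 1)) : Fin (n + m) → ℕ := by
  classical
  exact Fin.append (fun i => a i + h i * (σ i : ℕ))
    (fun j : Fin m => if ∃ i, σ i = j.succ then 1 else 2)

end

noncomputable section

section UpdateTheory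

open scoped Classical

/-! ### The convolution algebra of functions of finite sets -/

/-! Functions of finite subsets of `S` form a commutative semiring under convolution over splittings
`X = Y ⊎ W`. In it a PMBM density is, up to the factor `exp (-∫ λ)`, a weighted sum of products of
one `poisson` element and `n` `bern` elements. Union of independent sets is multiplication.

The likelihood has the same shape on the measurement side. Let `A = SetAlg (Fin m) ℝ`; its elements
are polynomials in markers `s_1, …, s_m` with `s_j ^ 2 = 0`. Up to a constant, the likelihood of `X`
is the coefficient of `s_1 ⋯ s_m` in `poisson λ^C * ∏ x ∈ X, φ x`, where `φ x = ∑ k, s_k ℓ_k(x)`,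
`s_0 = 1`, `ℓ_0 = 1 - p^D` and `ℓ_j = l(Z^j | ·) p^D`. Pointwise multiplication by `∏ x ∈ X, φ x` is
a ring endomorphism of `SetAlg S A` (`twist`), so it acts on the Poisson and Bernoulli factors
separately. A Bernoulli factor becomes a sum over `k`. The Poisson factor becomes `poisson (λ ℓ_0)`
times factors `1 + s_j * bern 0 (λ ℓ_j)`, since `s_j ^ 2 = 0` leaves room for one object per
measurement; these absorb the clutter factors `1 + s_j λ^C_j`. Expanding and reading off the
coefficient of `s_1 ⋯ s_m` gives precisely the sum over data associations,
`likelihood_mul_eq_sum_associations`.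

Each resulting factor is a local weight times a normalised Bernoulli density, almost everywhere: if
the mass of a nonnegative function is zero, the function vanishes almost everywhere. Finally the set
integral of `poisson λ * ∏ i, bern (c i) (v i)` is `exp (∫ λ) * ∏ i, (c i + ∫ v i)`, because null
singletons make the points of a tuple almost surely distinct. This gives convergence and the
normalising constant, whose nonvanishing forces the total hypothesis weight to be nonzero. -/

/-- Functions of finite sets, with the product `(f * g) X = ∑_{Y ⊎ W = X} f Y * g W`. -/
def SetAlg (S R : Type*) : Type _ := Finset S → R

namespace SetAlg

variable {S R : Type*}

instance [AddCommMonoid R] : AddCommMonoid (SetAlg S R) :=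
  inferInstanceAs (AddCommMonoid (Finset S → R))

section Ring

variable [CommSemiring R]

instance : Mul (SetAlg S R) := ⟨fun f g X => ∑ Y ∈ X.powerset, f Y * g (X \ Y)⟩

/-- The function with value `c` at `Y` and `0` elsewhere. -/
def single (Y : Finset S) (c : R) : SetAlg S R := fun X => if X = Y then c else 0

instance : One (SetAlg S R) := ⟨single ∅ 1⟩

theorem mul_apply (f g : SetAlg S R) (X : Finset S) :
    (f * g) X = ∑ Y ∈ X.powerset, f Y * g (X \ Y) := rfl

theorem add_apply (f g : SetAlg S R) (X : Finset S) : (f + g) X = f X + g X := rfl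

theorem zero_apply (X : Finset S) : (0 : SetAlg S R) X = 0 := rfl

theorem one_def : (1 : SetAlg S R) = single ∅ 1 := rfl

theorem single_empty_mul_apply (c : R) (f : SetAlg S R) (X : Finset S) :
    (single ∅ c * f : SetAlg S R) X = c * f X := by
  rw [mul_apply, Finset.sum_eq_single ∅]
  · simp [single]
  · intro Y _ hY
    simp [single, hY]
  · simp

protected theorem mul_comm (f g : SetAlg S R) : f * g = g * f := by
  funext X
  rw [mul_apply, mul_apply]
  refine Finset.sum_bij' (fun Y _ => X \ Y) (fun Y _ => X \ Y) ?_ ?_ ?_ ?_ ?_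
  · simp
  · simp
  · intro Y hY
    simpa using Finset.mem_powerset.1 hY
  · intro Y hY
    simpa using Finset.mem_powerset.1 hY
  · intro Y hY
    rw [Finset.sdiff_sdiff_eq_self (Finset.mem_powerset.1 hY), mul_comm]

protected theorem mul_assoc (f g k : SetAlg S R) : f * g * k = f * (g * k) := by
  funext X
  simp only [mul_apply, Finset.sum_mul, Finset.mul_sum]
  rw [Finset.sum_sigma', Finset.sum_sigma']
  -- Both sides sum over ordered splittings of `X` into three parts: on the left indexed by the
  -- union of the first two parts and the first part, on the right by the first part and the second.
  refine Finset.sum_bij' (fun q _ => ⟨q.2, q.1 \ q.2⟩) (fun q _ => ⟨q.1 ∪ q.2, q.1⟩)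
    ?_ ?_ ?_ ?_ ?_
  · rintro ⟨Y, W⟩ h
    simp only [Finset.mem_sigma, Finset.mem_powerset] at h ⊢
    exact ⟨h.2.trans h.1, Finset.sdiff_subset_sdiff h.1 subset_rfl⟩
  · rintro ⟨W, V⟩ h
    simp only [Finset.mem_sigma, Finset.mem_powerset] at h ⊢
    exact ⟨Finset.union_subset h.1 (h.2.trans Finset.sdiff_subset), Finset.subset_union_left⟩
  · rintro ⟨Y, W⟩ h
    simp only [Finset.mem_sigma, Finset.mem_powerset] at h
    simp [Finset.union_sdiff_of_subset h.2]
  · rintro ⟨W, V⟩ h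
    simp only [Finset.mem_sigma, Finset.mem_powerset] at h
    have hd : Disjoint W V := (Finset.disjoint_of_subset_left h.2 Finset.sdiff_disjoint).symm
    simp [Finset.union_sdiff_cancel_left hd]
  · rintro ⟨Y, W⟩ h
    simp only [Finset.mem_sigma, Finset.mem_powerset] at h
    have : (X \ W) \ (Y \ W) = X \ Y := by
      ext x
      have := @h.2 x
      simp only [Finset.mem_sdiff]
      tauto
    rw [this, mul_assoc]

instance : CommSemiring (SetAlg S R) where
  mul_assoc := SetAlg.mul_assoc
  mul_comm := SetAlg.mul_comm
  one_mul f := by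
    funext X
    rw [one_def, single_empty_mul_apply, one_mul]
  mul_one f := by
    funext X
    rw [SetAlg.mul_comm, one_def, single_empty_mul_apply, one_mul]
  zero_mul f := by
    funext X
    simp [mul_apply, zero_apply]
  mul_zero f := by
    funext X
    simp [mul_apply, zero_apply]
  left_distrib f g k := by
    funext X
    simp [mul_apply, add_apply, mul_add, Finset.sum_add_distrib]
  right_distrib f g k := by
    funext X
    simp [mul_apply, add_apply, add_mul, Finset.sum_add_distrib]

theorem sum_apply {ι : Type*} (s : Finset ι) (f : ι → SetAlg S R) (X : Finset S) :
    (∑ i ∈ s, f i) X = ∑ i ∈ s, f i X :=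
  map_sum (⟨⟨fun f => f X, rfl⟩, fun _ _ => rfl⟩ : SetAlg S R →+ R) f s

/-- Constants, supported at the empty set. -/
def C : R →+* SetAlg S R where
  toFun c := single ∅ c
  map_one' := rfl
  map_mul' a b := by
    funext X
    rw [single_empty_mul_apply]
    simp [single]
  map_zero' := by
    funext X
    simp [single, zero_apply]
  map_add' a b := by
    funext X
    rw [add_apply]
    simp only [single]
    split_ifs <;> simp

theorem C_mul_apply (c : R) (f : SetAlg S R) (X : Finset S) :
    (C c * f : SetAlg S R) X = c * f X :=
  single_empty_mul_apply c f X

theorem mul_C_apply (c : R) (f : SetAlg S R) (X : Finset S) :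
    (f * C c : SetAlg S R) X = f X * c := by
  rw [mul_comm, C_mul_apply, mul_comm]

theorem C_apply (c : R) (X : Finset S) : (C c : SetAlg S R) X = if X = ∅ then c else 0 := rfl

/-- The product formula: a product of functions of finite sets is a sum over decompositions. -/
theorem prod_apply {ι : Type*} [Fintype ι] (f : ι → SetAlg S R) (X : Finset S) :
    (∏ i, f i) X = ∑ P ∈ decompositions ι X, ∏ i, f i (P i) := by
  -- Induction over the index set works with decompositions whose parts outside `s` are empty.
  have key : ∀ (s : Finset ι) (X : Finset S), (∏ i ∈ s, f i) X =
      ∑ P ∈ decompositions ι X with ∀ i, i ∉ s → P i = ∅, ∏ i ∈ s, f i (P i) := by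
    intro s
    induction s using Finset.induction_on with
    | empty =>
      intro X
      rw [Finset.prod_empty, one_def, single]
      split_ifs with h
      · subst h
        rw [Finset.sum_eq_single (fun _ => ∅)]
        · simp
        · intro P hP hne
          exact absurd (funext fun i => (Finset.mem_filter.1 hP).2 i (by simp)) hne
        · intro h
          refine absurd ?_ h
          simp only [decompositions, Finset.mem_filter, Fintype.mem_piFinset]
          refine ⟨⟨by simp, by simp, ?_⟩, by simp⟩
          ext
          simp
      · rw [Finset.sum_eq_zero]
        intro P hP
        exfalso
        simp only [decompositions, Finset.mem_filter] at hP
        apply h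
        rw [← hP.1.2.2]
        ext x
        simp [hP.2]
    | insert j s hj ih =>
      intro X
      rw [Finset.prod_insert hj, mul_apply]
      simp only [ih, Finset.mul_sum]
      rw [Finset.sum_sigma']
      -- The part with index `j` is empty before the step, so the factor's set `Y` can be stored
      -- there and recovered.
      refine Finset.sum_bij' (fun q _ => Function.update q.2 j q.1)
        (fun P _ => ⟨P j, Function.update P j ∅⟩) ?_ ?_ ?_ ?_ ?_
      · rintro ⟨Y, P⟩ h
        simp only [decompositions, Finset.mem_sigma, Finset.mem_powerset, Finset.mem_filter,
          Fintype.mem_piFinset] at h ⊢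
        obtain ⟨hY, ⟨hP, hd, hu⟩, he⟩ := h
        have hPj := he j hj
        have hPY : ∀ i, Disjoint Y (P i) := fun i =>
          Finset.disjoint_of_subset_right (hP i) Finset.disjoint_sdiff
        refine ⟨⟨fun i => ?_, fun i i' hi => ?_, ?_⟩, fun i hi => ?_⟩
        · by_cases h : i = j
          · subst h; simpa using hY
          · simpa [h] using (hP i).trans Finset.sdiff_subset
        · by_cases h : i = j
          · subst h
            simpa [hi.symm] using hPY i'
          · by_cases h' : i' = j
            · subst h'
              simpa [h] using (hPY i).symm
            · simpa [h, h'] using hd i i' hi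
        · ext x
          have hx := congrArg (x ∈ ·) hu
          simp only [Finset.mem_biUnion, Finset.mem_univ, true_and, Finset.mem_sdiff,
            eq_iff_iff] at hx ⊢
          constructor
          · rintro ⟨i, hi⟩
            by_cases h : i = j
            · subst h
              exact hY (by simpa using hi)
            · exact (hx.1 ⟨i, by simpa [h] using hi⟩).1
          · intro hxX
            by_cases hxY : x ∈ Y
            · exact ⟨j, by simpa using hxY⟩
            · obtain ⟨i, hi⟩ := hx.2 ⟨hxX, hxY⟩
              have : i ≠ j := by
                rintro rfl
                simp [hPj] at hi
              exact ⟨i, by simpa [this] using hi⟩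
        · rw [Finset.mem_insert, not_or] at hi
          simpa [hi.1] using he i hi.2
      · intro P h
        simp only [decompositions, Finset.mem_sigma, Finset.mem_powerset, Finset.mem_filter,
          Fintype.mem_piFinset] at h ⊢
        obtain ⟨⟨hP, hd, hu⟩, he⟩ := h
        refine ⟨hP j, ⟨fun i => ?_, fun i i' hi => ?_, ?_⟩, fun i hi => ?_⟩
        · by_cases h : i = j
          · subst h; simp
          · simpa [h] using Finset.subset_sdiff.2 ⟨hP i, hd i j h⟩
        · by_cases h : i = j
          · subst h
            simp
          · by_cases h' : i' = j
            · subst h'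
              simp
            · simpa [h, h'] using hd i i' hi
        · ext x
          have hx := congrArg (x ∈ ·) hu
          simp only [Finset.mem_biUnion, Finset.mem_univ, true_and, Finset.mem_sdiff,
            eq_iff_iff] at hx ⊢
          constructor
          · rintro ⟨i, hi⟩
            by_cases h : i = j
            · subst h
              simp at hi
            · rw [Function.update_of_ne h] at hi
              exact ⟨hP i hi, fun hj => Finset.disjoint_left.1 (hd i j h) hi hj⟩
          · rintro ⟨hxX, hxj⟩
            obtain ⟨i, hi⟩ := hx.2 hxX
            have : i ≠ j := by
              rintro rfl
              exact hxj hi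
            exact ⟨i, by simpa [this] using hi⟩
        · by_cases h : i = j
          · subst h; simp
          · simpa [h] using he i (by simp [h, hi])
      · rintro ⟨Y, P⟩ h
        simp only [Finset.mem_sigma, Finset.mem_filter] at h
        have := h.2.2 j hj
        simp [← this]
      · intro P _
        simp
      · rintro ⟨Y, P⟩ _
        rw [Finset.prod_insert hj]
        simp only [Function.update_self]
        congr 1
        refine Finset.prod_congr rfl fun i hi => ?_
        rw [Function.update_of_ne]
        rintro rfl
        exact hj hi
  rw [key]
  refine Finset.sum_congr ?_ fun _ _ => rfl
  simp

/-- Products evaluated at `X` depend only on the values of the factors at subsets of `X`. -/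
theorem mul_congr {f f' g g' : SetAlg S R} {X : Finset S} (hf : ∀ Y ⊆ X, f Y = f' Y)
    (hg : ∀ Y ⊆ X, g Y = g' Y) : ∀ Y ⊆ X, (f * g) Y = (f' * g') Y := by
  intro Y hY
  rw [mul_apply, mul_apply]
  refine Finset.sum_congr rfl fun W hW => ?_
  rw [hf W ((Finset.mem_powerset.1 hW).trans hY), hg _ (Finset.sdiff_subset.trans hY)]

theorem prod_congr {ι : Type*} {s : Finset ι} {f f' : ι → SetAlg S R} {X : Finset S}
    (hf : ∀ i ∈ s, ∀ Y ⊆ X, f i Y = f' i Y) : ∀ Y ⊆ X, (∏ i ∈ s, f i) Y = (∏ i ∈ s, f' i) Y := by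
  induction s using Finset.induction_on with
  | empty => simp
  | insert j s hj ih =>
    rw [Finset.prod_insert hj, Finset.prod_insert hj]
    exact mul_congr (hf j (Finset.mem_insert_self _ _))
      (ih fun i hi => hf i (Finset.mem_insert_of_mem hi))

/-! ### Poisson and Bernoulli elements -/

/-- The function `X ↦ ∏_{x ∈ X} v x`. -/
def poisson (v : S → R) : SetAlg S R := fun X => ∏ x ∈ X, v x

/-- The function with value `c` at `∅`, `v x` at `{x}`, and `0` at larger sets. -/
def bern (c : R) (v : S → R) : SetAlg S R :=
  fun X => if X.card = 0 then c else if X.card = 1 then ∏ x ∈ X, v x else 0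

theorem bern_empty (c : R) (v : S → R) : bern c v ∅ = c := by simp [bern]

theorem bern_singleton (c : R) (v : S → R) (x : S) : bern c v {x} = v x := by simp [bern]

theorem bern_of_one_lt_card (c : R) (v : S → R) {X : Finset S} (h : 1 < X.card) :
    bern c v X = 0 := by
  rw [bern, if_neg (by omega), if_neg (by omega)]

theorem card_cases (X : Finset S) : X = ∅ ∨ (∃ x, X = {x}) ∨ 1 < X.card := by
  rcases Nat.lt_trichotomy X.card 1 with h | h | h
  · exact Or.inl (Finset.card_eq_zero.1 (by omega))
  · exact Or.inr (Or.inl (Finset.card_eq_one.1 h))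
  · exact Or.inr (Or.inr h)

/-- A Bernoulli function is determined by its values at `∅` and at singletons. -/
theorem bern_eq_of {c : R} {v : S → R} {f : SetAlg S R} {X : Finset S} (h0 : f ∅ = c)
    (h1 : ∀ x ∈ X, f {x} = v x) (h2 : ∀ Y : Finset S, 1 < Y.card → f Y = 0) :
    ∀ Y ⊆ X, f Y = bern c v Y := by
  intro Y hY
  rcases card_cases Y with rfl | ⟨x, rfl⟩ | h
  · rw [bern_empty, h0]
  · rw [bern_singleton, h1 x (hY (Finset.mem_singleton_self x))]
  · rw [bern_of_one_lt_card _ _ h, h2 Y h]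

theorem eq_bern_of {c : R} {v : S → R} {f : SetAlg S R} (h0 : f ∅ = c)
    (h1 : ∀ x, f {x} = v x) (h2 : ∀ Y : Finset S, 1 < Y.card → f Y = 0) : f = bern c v :=
  funext fun X => bern_eq_of h0 (fun x _ => h1 x) h2 X subset_rfl

theorem C_mul_bern (a c : R) (v : S → R) : C a * bern c v = bern (a * c) (fun x => a * v x) :=
  eq_bern_of (by rw [C_mul_apply, bern_empty]) (fun x => by rw [C_mul_apply, bern_singleton])
    fun Y h => by rw [C_mul_apply, bern_of_one_lt_card _ _ h, mul_zero]

theorem bern_add_bern (c c' : R) (v v' : S → R) :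
    bern c v + bern c' v' = bern (c + c') (fun x => v x + v' x) :=
  eq_bern_of (by simp only [add_apply, bern_empty])
    (fun x => by simp only [add_apply, bern_singleton])
    fun Y h => by simp only [add_apply, bern_of_one_lt_card _ _ h, add_zero]

theorem C_eq_bern (c : R) : (C c : SetAlg S R) = bern c (fun _ => 0) :=
  eq_bern_of (by simp [C_apply]) (fun x => by simp [C_apply]) fun Y h => by
    rw [C_apply, if_neg]
    rintro rfl
    simp at h

theorem sum_bern {ι : Type*} (s : Finset ι) (c : ι → R) (v : ι → S → R) :
    ∑ i ∈ s, bern (c i) (v i) = bern (∑ i ∈ s, c i) (fun x => ∑ i ∈ s, v i x) :=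
  eq_bern_of (by simp only [sum_apply, bern_empty])
    (fun x => by simp only [sum_apply, bern_singleton])
    fun Y h => by simp only [sum_apply, bern_of_one_lt_card _ _ h, Finset.sum_const_zero]

/-- In the convolution sum only `∅` and the singletons of `X` carry a nonzero Bernoulli value. -/
theorem mul_bern_apply (f : SetAlg S R) (c : R) (v : S → R) (X : Finset S) :
    (f * bern c v) X = c * f X + ∑ x ∈ X, v x * f (X \ {x}) := by
  rw [mul_comm f, mul_apply]
  have hsub : insert ∅ (X.image fun x => {x}) ⊆ X.powerset := by
    intro Y hY
    rcases Finset.mem_insert.1 hY with rfl | hY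
    · simp
    · obtain ⟨x, hx, rfl⟩ := Finset.mem_image.1 hY
      simpa using hx
  rw [← Finset.sum_subset hsub, Finset.sum_insert, Finset.sum_image]
  · simp [bern_empty, bern_singleton]
  · intro x _ y _ h
    simpa using h
  · simp
  · intro Y hY hn
    rcases card_cases Y with rfl | ⟨x, rfl⟩ | h
    · simp at hn
    · simp only [Finset.mem_powerset, Finset.singleton_subset_iff] at hY
      simp [hY] at hn
    · rw [bern_of_one_lt_card _ _ h, zero_mul]

/-- Superposition: expanding `∏ (v x + v' x)` chooses the subset of points that come from `v`. -/
theorem poisson_add (v v' : S → R) : poisson (fun x => v x + v' x) = poisson v * poisson v' := by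
  funext X
  rw [mul_apply]
  exact Finset.prod_add v v' X

theorem poisson_zero : poisson (fun _ : S => (0 : R)) = 1 := by
  funext X
  rw [one_def, single, poisson, Finset.prod_const]
  by_cases h : X = ∅
  · simp [h]
  · rw [if_neg h, zero_pow (by simpa using h)]

theorem poisson_sum {ι : Type*} (s : Finset ι) (v : ι → S → R) :
    poisson (fun x => ∑ i ∈ s, v i x) = ∏ i ∈ s, poisson (v i) := by
  induction s using Finset.induction_on with
  | empty => simpa using poisson_zero
  | insert j s hj ih =>
    simp only [Finset.sum_insert hj, Finset.prod_insert hj]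
    rw [poisson_add, ih]

/-- A Poisson function whose intensity is a multiple of a square-zero element is Bernoulli. -/
theorem poisson_mul_of_sq_eq_zero {s : R} (hs : s * s = 0) (v : S → R) :
    poisson (fun x => s * v x) = 1 + C s * bern 0 v := by
  rw [C_mul_bern, ← map_one C, C_eq_bern, bern_add_bern]
  refine eq_bern_of (by simp [poisson]) (fun x => by simp [poisson]) fun Y h => ?_
  -- On a set of at least two points the product contains the factor `s * s`.
  rw [poisson, Finset.prod_mul_distrib, Finset.prod_const]
  obtain ⟨k, hk⟩ := Nat.exists_eq_add_of_le h
  rw [hk, pow_add, Nat.succ_eq_add_one, one_add_one_eq_two, pow_two, hs, zero_mul, zero_mul]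

/-! ### Indicators as squarefree monomials -/

theorem single_mul_single (Y W : Finset S) :
    (single Y 1 * single W 1 : SetAlg S R) = if Disjoint Y W then single (Y ∪ W) 1 else 0 := by
  funext X
  rw [mul_apply]
  have hterm : ∀ V ∈ X.powerset, (single Y 1 : SetAlg S R) V * (single W 1 : SetAlg S R) (X \ V) =
      if V = Y ∧ X \ V = W then 1 else 0 := by
    intro V _
    simp only [single, ite_and, mul_ite, mul_one, mul_zero]
    split_ifs <;> rfl
  rw [Finset.sum_congr rfl hterm]
  by_cases hd : Disjoint Y W
  · rw [if_pos hd, single]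
    split_ifs with h
    · subst h
      rw [Finset.sum_eq_single Y]
      · rw [if_pos ⟨rfl, Finset.union_sdiff_cancel_left hd⟩]
      · intro V _ hV
        rw [if_neg fun h => hV h.1]
      · intro h
        exact absurd (Finset.mem_powerset.2 Finset.subset_union_left) h
    · refine Finset.sum_eq_zero fun V hV => if_neg ?_
      rintro ⟨rfl, rfl⟩
      exact h (Finset.union_sdiff_of_subset (Finset.mem_powerset.1 hV)).symm
  · rw [if_neg hd, zero_apply]
    refine Finset.sum_eq_zero fun V hV => if_neg ?_
    rintro ⟨rfl, rfl⟩
    exact hd Finset.disjoint_sdiff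

/-- The elements `single Y 1` multiply like squarefree monomials with square-zero variables: any
overlap kills the product. -/
theorem prod_single {ι : Type*} (s : Finset ι) (Y : ι → Finset S) :
    (∏ i ∈ s, single (Y i) 1 : SetAlg S R) =
      if (s : Set ι).PairwiseDisjoint Y then single (s.biUnion Y) 1 else 0 := by
  induction s using Finset.induction_on with
  | empty => simp [one_def]
  | insert j s hj ih =>
    rw [Finset.prod_insert hj, ih, Finset.biUnion_insert, Finset.coe_insert]
    have hiff : (insert j (s : Set ι)).PairwiseDisjoint Y ↔
        (s : Set ι).PairwiseDisjoint Y ∧ Disjoint (Y j) (s.biUnion Y) := by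
      rw [Set.pairwiseDisjoint_insert_of_notMem (by simpa using hj), Finset.disjoint_biUnion_right]
      simp
    by_cases h : (s : Set ι).PairwiseDisjoint Y
    · rw [if_pos h, single_mul_single]
      simp [hiff, h]
    · rw [if_neg h, mul_zero, if_neg fun h' => h (hiff.1 h').1]

/-! ### Homomorphisms: twisting, change of coefficients, restriction -/

/-- Multiplication of the value at `X` by `∏_{x ∈ X} φ x`. -/
def twist (φ : S → R) : SetAlg S R →+* SetAlg S R where
  toFun f := fun X => f X * ∏ x ∈ X, φ x
  map_one' := by
    funext X
    rw [one_def, single]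
    split_ifs with h <;> simp [h]
  map_zero' := by
    funext X
    simp [zero_apply]
  map_add' f g := by
    funext X
    exact add_mul _ _ _
  map_mul' f g := by
    funext X
    change (∑ Y ∈ X.powerset, f Y * g (X \ Y)) * _ =
      ∑ Y ∈ X.powerset, (f Y * ∏ x ∈ Y, φ x) * (g (X \ Y) * ∏ x ∈ X \ Y, φ x)
    rw [Finset.sum_mul]
    refine Finset.sum_congr rfl fun Y hY => ?_
    rw [← Finset.prod_sdiff (Finset.mem_powerset.1 hY)]
    ring

theorem twist_apply (φ : S → R) (f : SetAlg S R) (X : Finset S) :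
    twist φ f X = f X * ∏ x ∈ X, φ x := rfl

theorem twist_poisson (φ v : S → R) : twist φ (poisson v) = poisson fun x => v x * φ x :=
  funext fun _ => Finset.prod_mul_distrib.symm

theorem twist_bern (φ : S → R) (c : R) (v : S → R) :
    twist φ (bern c v) = bern c fun x => v x * φ x :=
  eq_bern_of (by simp [twist_apply, bern_empty]) (fun x => by simp [twist_apply, bern_singleton])
    fun Y h => by rw [twist_apply, bern_of_one_lt_card _ _ h, zero_mul]

/-- Change of coefficients. -/
def map {R' : Type*} [CommSemiring R'] (θ : R →+* R') : SetAlg S R →+* SetAlg S R' where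
  toFun f := fun X => θ (f X)
  map_one' := by
    funext X
    simp only [one_def, single]
    split_ifs <;> simp
  map_zero' := by
    funext X
    simp [zero_apply]
  map_add' f g := by
    funext X
    exact map_add θ _ _
  map_mul' f g := by
    funext X
    change θ (∑ Y ∈ X.powerset, f Y * g (X \ Y)) = ∑ Y ∈ X.powerset, θ (f Y) * θ (g (X \ Y))
    simp only [map_sum, map_mul]

theorem map_apply {R' : Type*} [CommSemiring R'] (θ : R →+* R') (f : SetAlg S R) (X : Finset S) :
    map θ f X = θ (f X) := rfl

theorem map_poisson {R' : Type*} [CommSemiring R'] (θ : R →+* R') (v : S → R) :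
    map θ (poisson v) = poisson fun x => θ (v x) :=
  funext fun X => map_prod θ v X

theorem map_bern {R' : Type*} [CommSemiring R'] (θ : R →+* R') (c : R) (v : S → R) :
    map θ (bern c v) = bern (θ c) fun x => θ (v x) :=
  eq_bern_of (by rw [map_apply, bern_empty]) (fun x => by rw [map_apply, bern_singleton])
    fun Y h => by rw [map_apply, bern_of_one_lt_card _ _ h, map_zero]

/-- Restriction along an embedding. -/
def comap {T : Type*} (e : T ↪ S) : SetAlg S R →+* SetAlg T R where
  toFun f := fun X => f (X.map e)
  map_one' := by
    funext X
    simp [one_def, single]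
  map_zero' := rfl
  map_add' _ _ := rfl
  map_mul' f g := by
    funext X
    change ∑ W ∈ (X.map e).powerset, f W * g (X.map e \ W) =
      ∑ Y ∈ X.powerset, f (Y.map e) * g ((X \ Y).map e)
    symm
    refine Finset.sum_bij (fun Y _ => Y.map e) ?_ ?_ ?_ ?_
    · intro Y hY
      simpa using hY
    · intro Y _ W _ h
      simpa using h
    · intro W hW
      obtain ⟨Y, hY, rfl⟩ := Finset.subset_map_iff.1 (Finset.mem_powerset.1 hW)
      exact ⟨Y, by simpa using hY, rfl⟩
    · intro Y _
      rw [Finset.map_sdiff]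

theorem comap_apply {T : Type*} (e : T ↪ S) (f : SetAlg S R) (X : Finset T) :
    comap e f X = f (X.map e) := rfl

theorem comap_poisson {T : Type*} (e : T ↪ S) (v : S → R) :
    comap e (poisson v) = poisson fun x => v (e x) :=
  funext fun X => Finset.prod_map X e v

theorem comap_bern {T : Type*} (e : T ↪ S) (c : R) (v : S → R) :
    comap e (bern c v) = bern c fun x => v (e x) :=
  eq_bern_of (by rw [comap_apply, Finset.map_empty, bern_empty])
    (fun x => by rw [comap_apply, Finset.map_singleton, bern_singleton])
    fun Y h => by rw [comap_apply, bern_of_one_lt_card _ _ (by simpa using h)]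

end Ring

end SetAlg

/-! ### Data association -/

namespace SetAlg

variable {S : Type*} {n m : ℕ}

/-- The set of measurements assigned to a component by the value `k` of an association. -/
def assigned (k : Fin (m + 1)) : Finset (Fin m) := {j | k = j.succ}

theorem assigned_zero : assigned (0 : Fin (m + 1)) = ∅ := by
  ext j
  simp [assigned, (Fin.succ_ne_zero j).symm]

theorem assigned_succ (j : Fin m) : assigned j.succ = {j} := by
  ext j'
  simp [assigned, eq_comm]

/-- The set of measurements not assigned to any component. -/
def unassigned (σ : Fin n → Fin (m + 1)) : Finset (Fin m) := {j | ¬∃ i, σ i = j.succ}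

/-- The square-zero indeterminate of the measurement `k`, or `1` if `k = 0`. -/
def marker (k : Fin (m + 1)) : SetAlg (Fin m) ℝ := single (assigned k) 1

theorem marker_zero : marker (0 : Fin (m + 1)) = 1 := by
  rw [marker, assigned_zero, one_def]

theorem marker_succ (j : Fin m) : marker j.succ = single {j} 1 := by
  rw [marker, assigned_succ]

theorem marker_succ_mul_self (j : Fin m) : marker j.succ * marker j.succ = 0 := by
  rw [marker_succ, single_mul_single, if_neg (by simp)]

theorem mem_associations {σ : Fin n → Fin (m + 1)} :
    σ ∈ associations n m ↔ ∀ i i', σ i = σ i' → σ i ≠ 0 → i = i' := by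
  simp [associations]

/-- The value `0` contributes the empty set, so it may repeat; a nonzero value contributes a
singleton, so it may not. -/
theorem pairwiseDisjoint_assigned {σ : Fin n → Fin (m + 1)} :
    (Set.univ : Set (Fin n)).PairwiseDisjoint (fun i => assigned (σ i)) ↔
      σ ∈ associations n m := by
  rw [mem_associations]
  constructor
  · intro h i i' he h0
    by_contra hne
    obtain ⟨j, hj⟩ := Fin.exists_succ_eq.2 h0
    have := h (Set.mem_univ i) (Set.mem_univ i') hne
    rw [Function.onFun, ← he, ← hj, assigned_succ] at this
    simp at this
  · intro h i _ i' _ hne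
    rw [Function.onFun, Finset.disjoint_left]
    intro j hj hj'
    simp only [assigned, Finset.mem_filter, Finset.mem_univ, true_and] at hj hj'
    exact hne (h i i' (hj.trans hj'.symm) (hj ▸ Fin.succ_ne_zero j))

theorem prod_marker_succ (V : Finset (Fin m)) : ∏ j ∈ V, marker j.succ = single V 1 := by
  simp only [marker_succ]
  rw [prod_single, if_pos]
  · congr 1
    ext
    simp
  · intro i _ j _ h
    simpa using h

/-- The coefficient of `s_1 ⋯ s_m` survives exactly when every measurement is used once, either by
`V` or by one component. This is where the combinatorics of data association comes from. -/
theorem markers_apply_univ (V : Finset (Fin m)) (σ : Fin n → Fin (m + 1)) :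
    ((∏ j ∈ V, marker j.succ) * ∏ i, marker (σ i) : SetAlg (Fin m) ℝ) Finset.univ =
      if σ ∈ associations n m ∧ V = unassigned σ then 1 else 0 := by
  rw [prod_marker_succ]
  simp only [marker]
  rw [prod_single, Finset.coe_univ]
  by_cases hσ : σ ∈ associations n m
  · rw [if_pos (pairwiseDisjoint_assigned.2 hσ), single_mul_single]
    generalize hU : @Finset.biUnion _ _ (Classical.decEq _) _ _ = U
    have hmem : ∀ j, j ∈ U ↔ j ∉ unassigned σ := by
      intro j
      simp [← hU, assigned, unassigned]
    by_cases hVu : V = unassigned σ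
    · have hd : Disjoint V U := by
        rw [Finset.disjoint_left]
        intro j hj
        rwa [hmem, not_not, ← hVu]
      rw [if_pos (⟨hσ, hVu⟩ : _ ∧ _), if_pos hd]
      refine if_pos ?_
      ext j
      simp only [Finset.mem_univ, Finset.mem_union, hmem, hVu, true_iff]
      exact em _
    · rw [if_neg (fun h : _ ∧ _ => hVu h.2)]
      split_ifs with hd
      · refine if_neg fun hu => hVu ?_
        ext j
        have h1 := congrArg (j ∈ ·) hu
        simp only [Finset.mem_univ, Finset.mem_union, hmem, eq_iff_iff, true_iff] at h1
        have h2 : j ∈ V → j ∉ U := fun h => Finset.disjoint_left.1 hd h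
        rw [hmem, not_not] at h2
        exact ⟨h2, fun h => h1.resolve_right (not_not.2 h)⟩
      · rfl
  · rw [if_neg fun h => hσ (pairwiseDisjoint_assigned.1 h),
      if_neg (fun h : _ ∧ _ => hσ h.1), mul_zero,
      zero_apply]

/-- An object yields at most one measurement, so its measurement element is linear in the markers.
-/
theorem bern_eq_sum_marker (d : Fin (m + 1) → ℝ) :
    (bern (d 0) fun j => d j.succ : SetAlg (Fin m) ℝ) = ∑ k, marker k * C (d k) := by
  symm
  apply eq_bern_of
  · rw [sum_apply, Fin.sum_univ_succ]
    simp [mul_C_apply, marker_zero, marker_succ, single, one_def]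
  · intro j
    rw [sum_apply, Fin.sum_univ_succ]
    simp [mul_C_apply, marker_zero, marker_succ, single, one_def]
  · intro Y hY
    rw [sum_apply]
    refine Finset.sum_eq_zero fun k _ => ?_
    rw [mul_C_apply, marker, single, if_neg, zero_mul]
    rintro rfl
    rcases Fin.eq_zero_or_eq_succ k with rfl | ⟨j, rfl⟩
    · simp [assigned_zero] at hY
    · simp [assigned_succ] at hY

theorem poisson_eq_prod_marker (lamC : Fin m → ℝ) :
    (poisson lamC : SetAlg (Fin m) ℝ) = ∏ j, (1 + marker j.succ * C (lamC j)) := by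
  funext X
  rw [Finset.prod_one_add, sum_apply, Finset.sum_eq_single X]
  · rw [Finset.prod_mul_distrib, ← map_prod, mul_C_apply, prod_marker_succ, single, if_pos rfl,
      one_mul, poisson]
  · intro V _ hV
    rw [Finset.prod_mul_distrib, ← map_prod, mul_C_apply, prod_marker_succ, single,
      if_neg hV.symm, zero_mul]
  · simp

/-- The twisted intensity is a sum over `k`, so the Poisson element factors. The factors with a
square-zero marker truncate to at most one object; the misdetection factor stays Poisson. -/
theorem twist_map_poisson (ℓ : Fin (m + 1) → S → ℝ) (lam : S → ℝ) :
    twist (fun x => ∑ k, marker k * C (ℓ k x)) (map C (poisson lam)) =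
      map C (poisson fun x => lam x * ℓ 0 x) *
        ∏ j : Fin m, (1 + C (marker j.succ) * map C (bern 0 fun x => lam x * ℓ j.succ x)) := by
  rw [map_poisson, twist_poisson]
  have h : ∀ x, (C (lam x) * ∑ k, marker k * C (ℓ k x) : SetAlg (Fin m) ℝ) =
      ∑ k, marker k * C (lam x * ℓ k x) := by
    intro x
    rw [Finset.mul_sum]
    refine Finset.sum_congr rfl fun k _ => ?_
    rw [map_mul]
    ring
  simp only [h]
  rw [poisson_sum, Fin.prod_univ_succ, map_poisson]
  simp only [marker_zero, one_mul]
  congr 1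
  refine Finset.prod_congr rfl fun j _ => ?_
  rw [poisson_mul_of_sq_eq_zero (marker_succ_mul_self j), map_bern, map_zero]

/-- Twisting does not change the value at `∅`, so nonexistence is kept in the misdetection term
only: a detected component exists. -/
theorem twist_map_bern (ℓ : Fin (m + 1) → S → ℝ) (c : ℝ) (v : S → ℝ) :
    twist (fun x => ∑ k, marker k * C (ℓ k x)) (map C (bern c v)) =
      ∑ k : Fin (m + 1), C (marker k) *
        map C (bern (if k = 0 then c else 0) fun x => v x * ℓ k x) := by
  rw [map_bern, twist_bern]
  simp only [map_bern, C_mul_bern]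
  rw [sum_bern]
  congr 1
  · rw [Fin.sum_univ_succ]
    simp [marker_zero, Fin.succ_ne_zero]
  · funext x
    rw [Finset.mul_sum]
    refine Finset.sum_congr rfl fun k _ => ?_
    rw [map_mul]
    ring

/-- The cross term, in which one measurement is both clutter and object, carries the square of its
marker. The two origins therefore add up to one Bernoulli element, with the clutter mass at `∅`. -/
theorem clutter_mul_factor (lamC : ℝ) (v : S → ℝ) (j : Fin m) :
    (C (1 + marker j.succ * C lamC) * (1 + C (marker j.succ) * map C (bern 0 v)) :
      SetAlg S (SetAlg (Fin m) ℝ)) = 1 + C (marker j.succ) * map C (bern lamC v) := by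
  have hb : (bern lamC v : SetAlg S ℝ) = C lamC + bern 0 v := by
    rw [C_eq_bern, bern_add_bern]
    simp
  have hc : (map C (C lamC) : SetAlg S (SetAlg (Fin m) ℝ)) = C (C lamC) := by
    rw [C_eq_bern lamC, map_bern, map_zero, ← C_eq_bern, C_eq_bern lamC]
  have hs : (C (marker j.succ) * C (marker j.succ) : SetAlg S (SetAlg (Fin m) ℝ)) = 0 := by
    rw [← map_mul, marker_succ_mul_self, map_zero]
  rw [hb, map_add, map_add, map_mul, map_one, hc]
  generalize (C (marker j.succ) : SetAlg S (SetAlg (Fin m) ℝ)) = s at hs ⊢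
  generalize (C (C lamC) : SetAlg S (SetAlg (Fin m) ℝ)) = a
  generalize (map C (bern 0 v) : SetAlg S (SetAlg (Fin m) ℝ)) = b
  have : (1 + s * a) * (1 + s * b) = 1 + s * (a + b) + s * s * (a * b) := by ring
  rw [this, hs, zero_mul, add_zero]

/-- The likelihood of `m` measurements, times a Poisson multi-Bernoulli function, is a sum over
data associations of Poisson multi-Bernoulli functions. -/
theorem likelihood_mul_eq_sum_associations (lamC : Fin m → ℝ) (ℓ : Fin (m + 1) → S → ℝ)
    (lam : S → ℝ) (c : Fin n → ℝ) (v : Fin n → S → ℝ) (X : Finset S) :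
    (poisson lamC * ∏ x ∈ X, bern (ℓ 0 x) (fun j => ℓ j.succ x) : SetAlg (Fin m) ℝ) Finset.univ *
        (poisson lam * ∏ i, bern (c i) (v i) : SetAlg S ℝ) X =
      ∑ σ ∈ associations n m,
        (poisson (fun x => lam x * ℓ 0 x) *
          (∏ j ∈ unassigned σ, bern (lamC j) fun x => lam x * ℓ j.succ x) *
          ∏ i, bern (if σ i = 0 then c i else 0) fun x => v i x * ℓ (σ i) x : SetAlg S ℝ) X := by
  set φ : S → SetAlg (Fin m) ℝ := fun x => ∑ k, marker k * C (ℓ k x) with hφ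
  have hφ' : ∀ x, bern (ℓ 0 x) (fun j => ℓ j.succ x) = φ x := fun x =>
    bern_eq_sum_marker fun k => ℓ k x
  simp only [hφ']
  -- The two real factors are merged into one coefficient of an element of `SetAlg S A`, with `A =
  -- SetAlg (Fin m) ℝ`.
  have h1 : (poisson lamC * ∏ x ∈ X, φ x : SetAlg (Fin m) ℝ) Finset.univ *
        (poisson lam * ∏ i, bern (c i) (v i) : SetAlg S ℝ) X =
      (C (poisson lamC) * twist φ (map C (poisson lam * ∏ i, bern (c i) (v i))) :
        SetAlg S (SetAlg (Fin m) ℝ)) X Finset.univ := by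
    rw [C_mul_apply, twist_apply, map_apply, mul_comm (C _), ← mul_assoc, mul_C_apply]
  -- Expansion of all factors: `V` collects the measurements that take the term `s_j * bern`, and
  -- `σ` the chosen term of each old component.
  have h2 : (C (poisson lamC) * twist φ (map C (poisson lam * ∏ i, bern (c i) (v i))) :
        SetAlg S (SetAlg (Fin m) ℝ)) =
      ∑ V : Finset (Fin m), ∑ σ : Fin n → Fin (m + 1),
        C ((∏ j ∈ V, marker j.succ) * ∏ i, marker (σ i)) *
        map C (poisson (fun x => lam x * ℓ 0 x) *
          (∏ j ∈ V, bern (lamC j) fun x => lam x * ℓ j.succ x) *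
          ∏ i, bern (if σ i = 0 then c i else 0) fun x => v i x * ℓ (σ i) x) := by
    rw [map_mul, map_mul, map_prod, map_prod, twist_map_poisson]
    simp only [hφ, twist_map_bern]
    rw [poisson_eq_prod_marker, map_prod, ← mul_assoc, mul_left_comm, ← Finset.prod_mul_distrib]
    simp only [clutter_mul_factor]
    rw [Finset.prod_one_add, Finset.prod_univ_sum, Fintype.piFinset_univ, mul_assoc,
      Finset.sum_mul_sum, Finset.powerset_univ, Finset.mul_sum]
    refine Finset.sum_congr rfl fun V _ => ?_
    rw [Finset.mul_sum]
    refine Finset.sum_congr rfl fun σ _ => ?_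
    simp only [Finset.prod_mul_distrib, map_mul, map_prod]
    ring
  -- Reading the coefficient at `univ` leaves `V = unassigned σ`, so the sum over `V` collapses.
  rw [h1, h2, sum_apply, sum_apply]
  simp only [sum_apply, C_mul_apply, map_apply, mul_C_apply, markers_apply_univ, ite_and, ite_mul,
    one_mul, zero_mul]
  rw [Finset.sum_comm]
  simp only [Finset.sum_ite_irrel, Finset.sum_const_zero, Finset.sum_ite_eq', Finset.mem_univ,
    if_true]
  rw [← Finset.sum_filter]
  congr 1
  ext σ
  simp

end SetAlg

/-! ### Set integrals -/

section SetIntegral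

theorem toFiniteSet_sdiff_singleton {S : Type*} {n : ℕ} {x : Fin (n + 1) → S}
    (hx : Function.Injective x) (k : Fin (n + 1)) : toFiniteSet x \ {x k} = toFiniteSet (k.removeNth x) := by
  ext y
  simp only [toFiniteSet, Finset.mem_sdiff, Finset.mem_image, Finset.mem_univ, true_and,
    Finset.mem_singleton, Fin.removeNth]
  constructor
  · rintro ⟨⟨i, rfl⟩, h⟩
    obtain ⟨j, rfl⟩ := Fin.exists_succAbove_eq (x := i) (y := k) (by rintro rfl; exact h rfl)
    exact ⟨j, rfl⟩
  · rintro ⟨j, rfl⟩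
    exact ⟨⟨_, rfl⟩, fun h => Fin.succAbove_ne k j (hx h)⟩

theorem sum_toFiniteSet_eq {S : Type*} {n : ℕ} {x : Fin n → S}
    (hx : Function.Injective x) (F : S → ℝ) :
    ∑ y ∈ toFiniteSet x, F y = ∑ k, F (x k) := by
  rw [toFiniteSet, Finset.sum_image]
  exact fun i _ j _ h => hx h

variable {S : Type*} [MeasurableSpace S] {μ : Measure S}

theorem SetIntegrable.congr {f g : Finset S → ℝ} (hf : SetIntegrable μ f) (h : DensityEq μ f g) :
    SetIntegrable μ g := by
  refine ⟨fun n => (hf.1 n).congr (h n), ?_⟩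
  convert hf.2 using 1
  funext n
  rw [setIntegralTerm, setIntegralTerm, integral_congr_ae (h n)]

theorem setIntegral_congr {f g : Finset S → ℝ} (h : DensityEq μ f g) :
    setIntegral μ f = setIntegral μ g := by
  unfold setIntegral setIntegralTerm
  congr 1
  funext n
  rw [integral_congr_ae (h n)]

theorem setIntegralTerm_const_mul (c : ℝ) (f : Finset S → ℝ) (n : ℕ) :
    setIntegralTerm μ (fun X => c * f X) n = c * setIntegralTerm μ f n := by
  rw [setIntegralTerm, setIntegralTerm, integral_const_mul]
  ring

theorem SetIntegrable.const_mul {f : Finset S → ℝ} (hf : SetIntegrable μ f) (c : ℝ) :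
    SetIntegrable μ fun X => c * f X := by
  refine ⟨fun n => (hf.1 n).const_mul c, ?_⟩
  rw [funext (setIntegralTerm_const_mul c f)]
  exact hf.2.mul_left c

theorem setIntegral_const_mul (c : ℝ) (f : Finset S → ℝ) :
    setIntegral μ (fun X => c * f X) = c * setIntegral μ f := by
  unfold setIntegral
  simp only [setIntegralTerm_const_mul, tsum_mul_left]

theorem setIntegralTerm_sum {ι : Type*} (s : Finset ι) {f : ι → Finset S → ℝ}
    (hf : ∀ i ∈ s, SetIntegrable μ (f i)) (n : ℕ) :
    setIntegralTerm μ (fun X => ∑ i ∈ s, f i X) n = ∑ i ∈ s, setIntegralTerm μ (f i) n := by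
  simp only [setIntegralTerm]
  rw [integral_finsetSum s fun i hi => (hf i hi).1 n, Finset.mul_sum]

theorem SetIntegrable.sum {ι : Type*} {s : Finset ι} {f : ι → Finset S → ℝ}
    (hf : ∀ i ∈ s, SetIntegrable μ (f i)) : SetIntegrable μ fun X => ∑ i ∈ s, f i X := by
  refine ⟨fun n => integrable_finsetSum s fun i hi => (hf i hi).1 n, ?_⟩
  simp only [funext (setIntegralTerm_sum s hf)]
  exact summable_sum fun i hi => (hf i hi).2

theorem setIntegral_sum {ι : Type*} {s : Finset ι} {f : ι → Finset S → ℝ}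
    (hf : ∀ i ∈ s, SetIntegrable μ (f i)) :
    setIntegral μ (fun X => ∑ i ∈ s, f i X) = ∑ i ∈ s, setIntegral μ (f i) := by
  unfold setIntegral
  simp only [setIntegralTerm_sum s hf]
  exact Summable.tsum_finsetSum fun i hi => (hf i hi).2

variable [SigmaFinite μ]

theorem ae_forall_of_ae {p : S → Prop} (hp : ∀ᵐ x ∂μ, p x) (n : ℕ) :
    ∀ᵐ x : Fin n → S ∂(Measure.pi fun _ => μ), ∀ y ∈ toFiniteSet x, p y := by
  have : ∀ᵐ x : Fin n → S ∂(Measure.pi fun _ => μ), ∀ k, p (x k) :=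
    ae_all_iff.2 fun k => Measure.tendsto_eval_ae_ae.eventually hp
  filter_upwards [this] with x hx y hy
  simp only [toFiniteSet, Finset.mem_image] at hy
  obtain ⟨k, _, rfl⟩ := hy
  exact hx k

/-- Functions of finite sets that agree on the subsets of a conull set are equal as densities. -/
theorem densityEq_of_ae {p : S → Prop} (hp : ∀ᵐ x ∂μ, p x) {f g : Finset S → ℝ}
    (h : ∀ X : Finset S, (∀ x ∈ X, p x) → f X = g X) : DensityEq μ f g := fun n => by
  filter_upwards [ae_forall_of_ae hp n] with x hx
  exact h _ hx

variable [NullSingletonClass μ] [MeasurableEq S]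

/-- By Fubini each set `x i = x j` is null, because singletons are. Hence almost every `n`-tuple
gives a set with exactly `n` elements. -/
theorem ae_injective (n : ℕ) :
    ∀ᵐ x : Fin n → S ∂(Measure.pi fun _ => μ), Function.Injective x := by
  have key : ∀ i j : Fin n, i ≠ j → ∀ᵐ x : Fin n → S ∂(Measure.pi fun _ => μ), x i ≠ x j := by
    intro i j hij
    obtain ⟨n, rfl⟩ : ∃ k, n = k + 1 := ⟨n - 1, by have := i.2; omega⟩
    obtain ⟨k, rfl⟩ := Fin.exists_succAbove_eq hij.symm
    have hms : MeasurableSet {q : S × (Fin n → S) | q.1 = q.2 k} :=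
      measurableSet_eq_fun measurable_fst ((measurable_pi_apply k).comp measurable_snd)
    have hnull : (μ.prod (Measure.pi fun _ : Fin n => μ)) {q | q.1 = q.2 k} = 0 := by
      rw [Measure.measure_prod_null hms]
      refine Filter.Eventually.of_forall fun a => ?_
      have := Measure.pi_hyperplane (fun _ : Fin n => μ) k a
      simpa [eq_comm] using this
    have hmp := measurePreserving_piFinSuccAbove (fun _ : Fin (n + 1) => μ) i
    have := hmp.quasiMeasurePreserving.preimage_null hnull
    rw [ae_iff]
    simpa [Fin.removeNth] using this
  have := ae_all_iff.2 fun i => ae_all_iff.2 fun j => ae_all_iff.2 (key i j)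
  filter_upwards [this] with x hx i j h
  by_contra hne
  exact hx i j hne h

open SetAlg

/-- Convolution with a Bernoulli function multiplies the set integral by its total mass. -/
theorem SetIntegrable.mul_bern {f : SetAlg S ℝ} (hf : SetIntegrable μ f) (c : ℝ) {v : S → ℝ}
    (hv : Integrable v μ) : SetIntegrable μ (f * bern c v : SetAlg S ℝ) ∧
      setIntegral μ (f * bern c v : SetAlg S ℝ) = (c + ∫ x, v x ∂μ) * setIntegral μ f := by
  -- Fubini, with the point `x k` taken by the Bernoulli factor split off from the rest.
  have hterm : ∀ n (k : Fin (n + 1)),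
      Integrable (fun x : Fin (n + 1) → S => v (x k) * f (toFiniteSet (k.removeNth x)))
        (Measure.pi fun _ => μ) ∧
      ∫ x : Fin (n + 1) → S, v (x k) * f (toFiniteSet (k.removeNth x)) ∂(Measure.pi fun _ => μ) =
        (∫ x, v x ∂μ) * ∫ y : Fin n → S, f (toFiniteSet y) ∂(Measure.pi fun _ => μ) := by
    intro n k
    have hmp := measurePreserving_piFinSuccAbove (fun _ : Fin (n + 1) => μ) k
    constructor
    · exact hmp.integrable_comp_of_integrable (hv.mul_prod (hf.1 n))
    · rw [← integral_prod_mul]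
      exact hmp.integral_comp' (fun q : S × (Fin n → S) => v q.1 * f (toFiniteSet q.2))
  have hae : ∀ n, (fun x : Fin (n + 1) → S => (f * bern c v : SetAlg S ℝ) (toFiniteSet x))
      =ᵐ[Measure.pi fun _ => μ] fun x => c * f (toFiniteSet x) +
        ∑ k : Fin (n + 1), v (x k) * f (toFiniteSet (k.removeNth x)) := by
    intro n
    filter_upwards [ae_injective (μ := μ) (n + 1)] with x hx
    rw [mul_bern_apply, sum_toFiniteSet_eq hx]
    simp only [toFiniteSet_sdiff_singleton hx]
  have hae0 : (fun x : Fin 0 → S => (f * bern c v : SetAlg S ℝ) (toFiniteSet x)) =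
      fun x => c * f (toFiniteSet x) := by
    funext x
    rw [mul_bern_apply]
    simp [toFiniteSet]
  have hint : ∀ n, Integrable (fun x : Fin n → S => (f * bern c v : SetAlg S ℝ) (toFiniteSet x))
      (Measure.pi fun _ => μ) := by
    rintro (_ | n)
    · rw [hae0]
      exact (hf.1 0).const_mul c
    · refine Integrable.congr ?_ (hae n).symm
      exact ((hf.1 _).const_mul c).add (integrable_finsetSum _ fun k _ => (hterm n k).1)
  have hT0 : setIntegralTerm μ (f * bern c v : SetAlg S ℝ) 0 = c * setIntegralTerm μ f 0 := by
    unfold setIntegralTerm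
    rw [hae0, integral_const_mul]
    ring
  have hT : ∀ n, setIntegralTerm μ (f * bern c v : SetAlg S ℝ) (n + 1) =
      c * setIntegralTerm μ f (n + 1) + (∫ x, v x ∂μ) * setIntegralTerm μ f n := by
    intro n
    unfold setIntegralTerm
    rw [integral_congr_ae (hae n), integral_add ((hf.1 _).const_mul c)
      (integrable_finsetSum _ fun k _ => (hterm n k).1), integral_const_mul,
      integral_finsetSum _ fun k _ => (hterm n k).1]
    -- The `n + 1` choices of the Bernoulli point contribute equally, and `(n + 1) / (n + 1)! = 1 /
    -- n!`.
    simp only [(hterm n _).2, Finset.sum_const, Finset.card_univ,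
      Fintype.card_fin, nsmul_eq_mul, Nat.factorial_succ, Nat.cast_mul]
    have h1 : ((n + 1 : ℕ) : ℝ) ≠ 0 := by positivity
    have h2 : (n.factorial : ℝ) ≠ 0 := by positivity
    field_simp
  have hs1 : Summable fun n => setIntegralTerm μ f (n + 1) := (summable_nat_add_iff 1).2 hf.2
  have hsum : Summable (setIntegralTerm μ (f * bern c v : SetAlg S ℝ)) := by
    rw [← summable_nat_add_iff 1]
    simp only [hT]
    exact (hs1.mul_left c).add (hf.2.mul_left _)
  refine ⟨⟨hint, hsum⟩, ?_⟩
  unfold setIntegral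
  rw [hsum.tsum_eq_zero_add, hT0]
  simp only [hT]
  rw [(hs1.mul_left c).tsum_add (hf.2.mul_left _), tsum_mul_left, tsum_mul_left]
  have := hf.2.tsum_eq_zero_add
  linear_combination (-c) * this

/-- Off coincidences the integrand is a product over coordinates, so the set integral is the
exponential series of `∫ lam`. -/
theorem setIntegrable_poisson {lam : S → ℝ} (h : Integrable lam μ) :
    SetIntegrable μ (poisson lam : SetAlg S ℝ) ∧
      setIntegral μ (poisson lam : SetAlg S ℝ) = Real.exp (∫ x, lam x ∂μ) := by
  have hae : ∀ n, (fun x : Fin n → S => (poisson lam : SetAlg S ℝ) (toFiniteSet x))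
      =ᵐ[Measure.pi fun _ => μ] fun x => ∏ k, lam (x k) := by
    intro n
    filter_upwards [ae_injective (μ := μ) n] with x hx
    rw [poisson, toFiniteSet, Finset.prod_image fun i _ j _ h => hx h]
  have hT : ∀ n, setIntegralTerm μ (poisson lam : SetAlg S ℝ) n =
      (∫ x, lam x ∂μ) ^ n / n.factorial := by
    intro n
    unfold setIntegralTerm
    rw [integral_congr_ae (hae n),
      integral_fintype_prod_eq_prod (fun _ : Fin n => lam)]
    simp
    ring
  have hs : HasSum (setIntegralTerm μ (poisson lam : SetAlg S ℝ)) (Real.exp (∫ x, lam x ∂μ)) := by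
    rw [funext hT, Real.exp_eq_exp_ℝ]
    exact NormedSpace.expSeries_div_hasSum_exp _
  exact ⟨⟨fun n => (Integrable.fintype_prod fun _ => h).congr (hae n).symm, hs.summable⟩,
    hs.tsum_eq⟩

theorem setIntegrable_poisson_mul_prod_bern {ι : Type*} (s : Finset ι) {lam : S → ℝ}
    (h : Integrable lam μ) (c : ι → ℝ) {v : ι → S → ℝ} (hv : ∀ i ∈ s, Integrable (v i) μ) :
    SetIntegrable μ (poisson lam * ∏ i ∈ s, bern (c i) (v i) : SetAlg S ℝ) ∧
      setIntegral μ (poisson lam * ∏ i ∈ s, bern (c i) (v i) : SetAlg S ℝ) =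
        Real.exp (∫ x, lam x ∂μ) * ∏ i ∈ s, (c i + ∫ x, v i x ∂μ) := by
  induction s using Finset.induction_on with
  | empty => simpa using setIntegrable_poisson h
  | insert j s hj ih =>
    obtain ⟨h1, h2⟩ := ih fun i hi => hv i (Finset.mem_insert_of_mem hi)
    have h3 := h1.mul_bern (c j) (hv j (Finset.mem_insert_self _ _))
    rw [Finset.prod_insert hj, Finset.prod_insert hj, mul_left_comm, mul_comm (bern _ _)]
    refine ⟨h3.1, ?_⟩
    rw [h3.2, h2]
    ring

end SetIntegral

/-! ### Densities in terms of the convolution algebra -/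

section Densities

open SetAlg

variable {S : Type*}

theorem unionDensity_eq_prod {ι : Type*} [Fintype ι] (f : ι → Finset S → ℝ) :
    unionDensity f = (∏ i, (f i : SetAlg S ℝ) : SetAlg S ℝ) :=
  funext fun X => (prod_apply (S := S) (R := ℝ) f X).symm

theorem bernoulliDensity_eq_bern (r : ℝ) (p : S → ℝ) :
    bernoulliDensity r p = (bern (1 - r) fun x => r * p x : SetAlg S ℝ) := by
  refine eq_bern_of (f := (bernoulliDensity r p : SetAlg S ℝ)) ?_ ?_ ?_
  · simp [bernoulliDensity]
  · simp [bernoulliDensity]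
  · intro Y h
    rw [bernoulliDensity, if_neg (by omega), if_neg (by omega)]

theorem poissonUnionDensity_eq [MeasurableSpace S] (μ : Measure S) (lam : S → ℝ)
    (f : SetAlg S ℝ) (X : Finset S) :
    poissonUnionDensity μ lam f X = Real.exp (-∫ x, lam x ∂μ) * (poisson lam * f) X := by
  rw [mul_apply, Finset.mul_sum]
  exact Finset.sum_congr rfl fun Y _ => mul_assoc _ _ _

theorem toFiniteSet_eq_map {m : ℕ} {Z : Fin m → S} (hZ : Function.Injective Z) :
    toFiniteSet Z = Finset.univ.map ⟨Z, hZ⟩ := by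
  ext
  simp [toFiniteSet]

end Densities

/-! ### Normalised densities -/

section NormDensity

variable {S : Type*} [MeasurableSpace S] {μ : Measure S}

/-- The probability density proportional to `v`, or `p0` if `v` has integral zero. -/
def normDensity (μ : Measure S) (p0 v : S → ℝ) : S → ℝ :=
  if ∫ x, v x ∂μ = 0 then p0 else fun x => v x / ∫ x, v x ∂μ

theorem isProbDensity_normDensity {p0 v : S → ℝ} (hp0 : IsProbDensity μ p0) (hv : Measurable v)
    (hv0 : ∀ x, 0 ≤ v x) : IsProbDensity μ (normDensity μ p0 v) := by
  unfold normDensity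
  split_ifs with h
  · exact hp0
  · exact ⟨hv.div_const _, fun x => div_nonneg (hv0 x) (integral_nonneg hv0), by
      rw [integral_div, div_self h]⟩

theorem normDensity_of_ne_zero {p0 v : S → ℝ} (h : ∫ x, v x ∂μ ≠ 0) (x : S) :
    normDensity μ p0 v x = v x / ∫ x, v x ∂μ := by
  rw [normDensity, if_neg h]

/-- If the mass is zero, the nonnegative `v` vanishes almost everywhere and the arbitrary `p0` does
no harm. -/
theorem integral_mul_normDensity {p0 v : S → ℝ} (hv : Integrable v μ) (hv0 : ∀ x, 0 ≤ v x) :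
    ∀ᵐ x ∂μ, (∫ y, v y ∂μ) * normDensity μ p0 v x = v x := by
  by_cases h : ∫ x, v x ∂μ = 0
  · filter_upwards [(integral_eq_zero_iff_of_nonneg hv0 hv).1 h] with x hx
    rw [h, zero_mul, hx, Pi.zero_apply]
  · refine Filter.Eventually.of_forall fun x => ?_
    rw [normDensity_of_ne_zero h, mul_div_cancel₀ _ h]

/-- The Bochner integral of a nonintegrable function is `0` by convention, which is not `1`. -/
theorem IsProbDensity.integrable {p : S → ℝ} (hp : IsProbDensity μ p) : Integrable p μ := by
  by_contra h
  have := hp.integral_eq_one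
  rw [integral_undef h] at this
  exact zero_ne_one this

end NormDensity

/-! ### Indices of the updated local hypotheses -/

section Indices

/-- The predicted local hypothesis of the updated local hypothesis `b`. -/
def parentHyp (h b : ℕ) : ℕ := (b - 1) % h + 1

/-- The association of the updated local hypothesis `b`. -/
def hypAssoc (m h b : ℕ) : Fin (m + 1) := Fin.ofNat (m + 1) ((b - 1) / h)

/-- Indices start at `1`, so `b - 1 = (a - 1) + h * k` is a Euclidean division by `h` with remainder
`a - 1` and quotient `k`. -/
theorem parentHyp_add {h a : ℕ} (ha : a ∈ Finset.Icc 1 h) (k : ℕ) : parentHyp h (a + h * k) = a := by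
  rw [Finset.mem_Icc] at ha
  rw [parentHyp, show a + h * k - 1 = (a - 1) + h * k by omega, Nat.add_mul_mod_self_left,
    Nat.mod_eq_of_lt (by omega)]
  omega

theorem hypAssoc_add {m h a : ℕ} (ha : a ∈ Finset.Icc 1 h) (k : Fin (m + 1)) :
    hypAssoc m h (a + h * k) = k := by
  rw [Finset.mem_Icc] at ha
  rw [hypAssoc, show a + h * (k : ℕ) - 1 = (a - 1) + h * k by omega,
    Nat.add_mul_div_left _ _ (by omega), Nat.div_eq_of_lt (by omega), zero_add]
  exact Fin.ofNat_val_eq_self k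

theorem parentHyp_mem {h b c : ℕ} (hb : b ∈ Finset.Icc 1 (h * c)) :
    parentHyp h b ∈ Finset.Icc 1 h := by
  rw [Finset.mem_Icc] at hb ⊢
  have : 0 < h := Nat.pos_of_ne_zero (by rintro rfl; omega)
  have := Nat.mod_lt (b - 1) this
  rw [parentHyp]
  omega

variable {n m : ℕ}

theorem updatedHyp_castAdd (h a : Fin n → ℕ) (σ : Fin n → Fin (m + 1)) (i : Fin n) :
    updatedHyp h a σ (Fin.castAdd m i) = a i + h i * (σ i : ℕ) := by
  rw [updatedHyp, Fin.append_left]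

theorem updatedHyp_natAdd (h a : Fin n → ℕ) (σ : Fin n → Fin (m + 1)) (j : Fin m) :
    updatedHyp h a σ (Fin.natAdd n j) = if j ∈ SetAlg.unassigned σ then 2 else 1 := by
  rw [updatedHyp, Fin.append_right]
  simp only [SetAlg.unassigned, Finset.mem_filter, Finset.mem_univ, true_and, ite_not]

/-- The first `n` entries already determine `a` and `σ`, so sums over updated hypotheses are sums
over pairs without collisions. -/
theorem updatedHyp_injective {h : Fin n → ℕ} {a a' : Fin n → ℕ} {σ σ' : Fin n → Fin (m + 1)}
    (ha : ∀ i, a i ∈ Finset.Icc 1 (h i)) (ha' : ∀ i, a' i ∈ Finset.Icc 1 (h i))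
    (he : updatedHyp h a σ = updatedHyp h a' σ') : a = a' ∧ σ = σ' := by
  have he' : ∀ i, a i + h i * (σ i : ℕ) = a' i + h i * (σ' i : ℕ) := fun i => by
    rw [← updatedHyp_castAdd, ← updatedHyp_castAdd, he]
  constructor
  · funext i
    rw [← parentHyp_add (ha i) (σ i), he', parentHyp_add (ha' i)]
  · funext i
    rw [← hypAssoc_add (ha i) (σ i), he', hypAssoc_add (ha' i)]

end Indices

/-! ### The update -/

/-- A predicted PMBM density together with the detection probability, the single-object
likelihoods of `m` measurements and the clutter intensities at these measurements. -/
structure PMBMUpdate {S : Type*} [MeasurableSpace S] (μ : Measure S) (n m : ℕ) where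
  P : PMBM μ n
  pD : S → ℝ
  l : Fin m → S → ℝ
  lamC : Fin m → ℝ
  /-- the density of the hypotheses for which the update does not prescribe one -/
  p0 : S → ℝ
  pD_measurable : Measurable pD
  pD_nonneg : ∀ x, 0 ≤ pD x
  pD_le_one : ∀ x, pD x ≤ 1
  l_measurable : ∀ j, Measurable (l j)
  l_nonneg : ∀ j x, 0 ≤ l j x
  lamC_nonneg : ∀ j, 0 ≤ lamC j
  isProbDensity_p0 : IsProbDensity μ p0
  integrable_p : ∀ i, ∀ a ∈ Finset.Icc 1 (P.h i), ∀ j,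
    Integrable (fun x => P.p i a x * (l j x * pD x)) μ
  integrable_intensity : ∀ j, Integrable (fun x => P.intensity x * (l j x * pD x)) μ

namespace PMBMUpdate

open SetAlg

variable {S : Type*} [MeasurableSpace S] {μ : Measure S} {n m : ℕ} (U : PMBMUpdate μ n m)

/-- The factor by which an object is thinned: misdetection for `k = 0`, detection by the
measurement `k` otherwise. -/
def factor (k : Fin (m + 1)) (x : S) : ℝ := Fin.cases (1 - U.pD x) (fun j => U.l j x * U.pD x) k

theorem factor_zero (x : S) : U.factor 0 x = 1 - U.pD x := rfl

theorem factor_succ (j : Fin m) (x : S) : U.factor j.succ x = U.l j x * U.pD x := rfl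

theorem factor_measurable (k : Fin (m + 1)) : Measurable (U.factor k) := by
  rcases Fin.eq_zero_or_eq_succ k with rfl | ⟨j, rfl⟩
  · exact measurable_const.sub U.pD_measurable
  · exact (U.l_measurable j).mul U.pD_measurable

theorem factor_nonneg (k : Fin (m + 1)) (x : S) : 0 ≤ U.factor k x := by
  rcases Fin.eq_zero_or_eq_succ k with rfl | ⟨j, rfl⟩
  · exact sub_nonneg.2 (U.pD_le_one x)
  · exact mul_nonneg (U.l_nonneg j x) (U.pD_nonneg x)

theorem integrable_mul_pD {u : S → ℝ} (hu : Integrable u μ) :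
    Integrable (fun x => u x * U.pD x) μ :=
  hu.mul_bdd (c := 1) U.pD_measurable.aestronglyMeasurable
    (Filter.Eventually.of_forall fun x => by
      rw [Real.norm_of_nonneg (U.pD_nonneg x)]
      exact U.pD_le_one x)

theorem integrable_mul_factor_zero {u : S → ℝ} (hu : Integrable u μ) :
    Integrable (fun x => U.factor 0 x * u x) μ := by
  refine (hu.sub (U.integrable_mul_pD hu)).congr (Filter.Eventually.of_forall fun x => ?_)
  simp only [Pi.sub_apply, factor_zero]
  ring

theorem integral_mul_factor_zero {u : S → ℝ} (hu : Integrable u μ) :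
    ∫ x, U.factor 0 x * u x ∂μ = ∫ x, u x ∂μ - innerProd μ u U.pD := by
  rw [innerProd, ← integral_sub hu (U.integrable_mul_pD hu)]
  congr 1
  funext x
  rw [factor_zero]
  ring

theorem innerProd_one_sub_pD (u : S → ℝ) :
    innerProd μ u (fun x => 1 - U.pD x) = ∫ x, U.factor 0 x * u x ∂μ := by
  rw [innerProd]
  congr 1
  funext x
  rw [factor_zero, mul_comm]

theorem innerProd_l_mul_pD (u : S → ℝ) (j : Fin m) :
    innerProd μ u (fun x => U.l j x * U.pD x) = ∫ x, U.factor j.succ x * u x ∂μ := by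
  rw [innerProd]
  congr 1
  funext x
  rw [factor_succ, mul_comm]

theorem integrable_factor_mul_p {i : Fin n} {a : ℕ} (ha : a ∈ Finset.Icc 1 (U.P.h i))
    (k : Fin (m + 1)) : Integrable (fun x => U.factor k x * U.P.p i a x) μ := by
  rcases Fin.eq_zero_or_eq_succ k with rfl | ⟨j, rfl⟩
  · exact U.integrable_mul_factor_zero (U.P.isProbDensity i a ha).integrable
  · refine (U.integrable_p i a ha j).congr (Filter.Eventually.of_forall fun x => ?_)
    simp only [factor_succ]
    ring

theorem integrable_factor_mul_intensity (k : Fin (m + 1)) :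
    Integrable (fun x => U.factor k x * U.P.intensity x) μ := by
  rcases Fin.eq_zero_or_eq_succ k with rfl | ⟨j, rfl⟩
  · exact U.integrable_mul_factor_zero U.P.isIntensity.integrable
  · refine (U.integrable_intensity j).congr (Filter.Eventually.of_forall fun x => ?_)
    simp only [factor_succ]
    ring

theorem factor_mul_p_nonneg {i : Fin n} {a : ℕ} (ha : a ∈ Finset.Icc 1 (U.P.h i))
    (k : Fin (m + 1)) (x : S) : 0 ≤ U.factor k x * U.P.p i a x :=
  mul_nonneg (U.factor_nonneg k x) ((U.P.isProbDensity i a ha).nonneg x)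

theorem factor_mul_intensity_nonneg (k : Fin (m + 1)) (x : S) :
    0 ≤ U.factor k x * U.P.intensity x :=
  mul_nonneg (U.factor_nonneg k x) (U.P.isIntensity.nonneg x)

/-- Weight of the update of local hypothesis `a` of an existing component by association `k`. -/
def weightOld (i : Fin n) (a : ℕ) (k : Fin (m + 1)) : ℝ :=
  Fin.cases (1 - U.P.r i a * innerProd μ (U.P.p i a) U.pD)
    (fun j => U.P.r i a * innerProd μ (U.P.p i a) fun x => U.l j x * U.pD x) k

/-- Existence probability of the update of local hypothesis `a` of an existing component by
association `k`. -/
def existOld (i : Fin n) (a : ℕ) (k : Fin (m + 1)) : ℝ :=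
  Fin.cases (U.P.r i a * innerProd μ (U.P.p i a) (fun x => 1 - U.pD x) /
    (1 - U.P.r i a * innerProd μ (U.P.p i a) U.pD)) (fun _ => 1) k

/-- Since the density has mass `1`, the weight splits into the mass of nonexistence and the mass of
existing but being missed. This form shows nonnegativity and matches the Bernoulli element. -/
theorem weightOld_zero {i : Fin n} {a : ℕ} (ha : a ∈ Finset.Icc 1 (U.P.h i)) :
    U.weightOld i a 0 =
      1 - U.P.r i a + U.P.r i a * ∫ x, U.factor 0 x * U.P.p i a x ∂μ := by
  rw [U.integral_mul_factor_zero (U.P.isProbDensity i a ha).integrable,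
    (U.P.isProbDensity i a ha).integral_eq_one]
  simp only [weightOld, Fin.cases_zero]
  ring

theorem existOld_zero (i : Fin n) (a : ℕ) :
    U.existOld i a 0 =
      U.P.r i a * (∫ x, U.factor 0 x * U.P.p i a x ∂μ) / U.weightOld i a 0 := by
  rw [← innerProd_one_sub_pD]
  rfl

theorem weightOld_succ (i : Fin n) (a : ℕ) (j : Fin m) :
    U.weightOld i a j.succ = U.P.r i a * ∫ x, U.factor j.succ x * U.P.p i a x ∂μ := by
  rw [← innerProd_l_mul_pD]
  rfl

theorem existOld_succ (i : Fin n) (a : ℕ) (j : Fin m) : U.existOld i a j.succ = 1 := rfl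

theorem weightOld_nonneg {i : Fin n} {a : ℕ} (ha : a ∈ Finset.Icc 1 (U.P.h i)) (k : Fin (m + 1)) :
    0 ≤ U.weightOld i a k := by
  have hr := U.P.r_mem i a ha
  have hI : ∀ k, 0 ≤ ∫ x, U.factor k x * U.P.p i a x ∂μ := fun k =>
    integral_nonneg (U.factor_mul_p_nonneg ha k)
  rcases Fin.eq_zero_or_eq_succ k with rfl | ⟨j, rfl⟩
  · rw [U.weightOld_zero ha]
    exact add_nonneg (sub_nonneg.2 hr.2) (mul_nonneg hr.1 (hI 0))
  · rw [weightOld_succ]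
    exact mul_nonneg hr.1 (hI _)

theorem div_add_mem {c I : ℝ} (hc : 0 ≤ c) (hI : 0 ≤ I) : 0 ≤ I / (c + I) ∧ I / (c + I) ≤ 1 :=
  ⟨div_nonneg hI (add_nonneg hc hI), div_le_one_of_le₀ (by linarith) (add_nonneg hc hI)⟩

/-- When `c + I = 0`, nonnegativity forces `I = 0`, so the convention `0 / 0 = 0` is harmless. -/
theorem add_mul_div_add {c I : ℝ} (hc : 0 ≤ c) (hI : 0 ≤ I) : (c + I) * (I / (c + I)) = I := by
  by_cases h : c + I = 0
  · rw [h, zero_mul]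
    linarith
  · rw [mul_div_cancel₀ _ h]

theorem existOld_mem {i : Fin n} {a : ℕ} (ha : a ∈ Finset.Icc 1 (U.P.h i)) (k : Fin (m + 1)) :
    0 ≤ U.existOld i a k ∧ U.existOld i a k ≤ 1 := by
  have hr := U.P.r_mem i a ha
  rcases Fin.eq_zero_or_eq_succ k with rfl | ⟨j, rfl⟩
  · rw [existOld_zero, U.weightOld_zero ha]
    exact div_add_mem (sub_nonneg.2 hr.2)
      (mul_nonneg hr.1 (integral_nonneg (U.factor_mul_p_nonneg ha 0)))
  · rw [existOld_succ]
    exact ⟨zero_le_one, le_rfl⟩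

/-- Together with `weightOld_mul_one_sub_existOld`, this identifies weight times normalised
Bernoulli: here the mass on singletons, there the value at `∅`. -/
theorem weightOld_mul_existOld {i : Fin n} {a : ℕ} (ha : a ∈ Finset.Icc 1 (U.P.h i))
    (k : Fin (m + 1)) :
    U.weightOld i a k * U.existOld i a k =
      U.P.r i a * ∫ x, U.factor k x * U.P.p i a x ∂μ := by
  have hr := U.P.r_mem i a ha
  rcases Fin.eq_zero_or_eq_succ k with rfl | ⟨j, rfl⟩
  · rw [existOld_zero, U.weightOld_zero ha]
    exact add_mul_div_add (sub_nonneg.2 hr.2)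
      (mul_nonneg hr.1 (integral_nonneg (U.factor_mul_p_nonneg ha 0)))
  · rw [existOld_succ, mul_one, weightOld_succ]

theorem weightOld_mul_one_sub_existOld {i : Fin n} {a : ℕ} (ha : a ∈ Finset.Icc 1 (U.P.h i))
    (k : Fin (m + 1)) :
    U.weightOld i a k * (1 - U.existOld i a k) = if k = 0 then 1 - U.P.r i a else 0 := by
  rcases Fin.eq_zero_or_eq_succ k with rfl | ⟨j, rfl⟩
  · rw [if_pos rfl, mul_sub, U.weightOld_mul_existOld ha, U.weightOld_zero ha]
    ring
  · rw [existOld_succ, if_neg (Fin.succ_ne_zero j)]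
    ring

/-- Expected number of undetected objects that generate the measurement `j`. -/
def newMass (j : Fin m) : ℝ := innerProd μ U.P.intensity fun x => U.l j x * U.pD x

theorem newMass_eq (j : Fin m) :
    U.newMass j = ∫ x, U.factor j.succ x * U.P.intensity x ∂μ :=
  U.innerProd_l_mul_pD _ j

theorem newMass_nonneg (j : Fin m) : 0 ≤ U.newMass j := by
  rw [newMass_eq]
  exact integral_nonneg (U.factor_mul_intensity_nonneg _)

/-- Local weights of the updated hypotheses. -/
def localWeight : Fin (n + m) → ℕ → ℝ :=
  Fin.append (fun i b => U.weightOld i (parentHyp (U.P.h i) b) (hypAssoc m (U.P.h i) b))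
    (fun j b => if b = 1 then 1 else U.lamC j + U.newMass j)

/-- Existence probabilities of the updated hypotheses. -/
def exist : Fin (n + m) → ℕ → ℝ :=
  Fin.append (fun i b => U.existOld i (parentHyp (U.P.h i) b) (hypAssoc m (U.P.h i) b))
    (fun j b => if b = 1 then 0 else U.newMass j / (U.lamC j + U.newMass j))

/-- Single-object densities of the updated hypotheses. -/
def dens : Fin (n + m) → ℕ → S → ℝ :=
  Fin.append (fun i b => normDensity μ U.p0 fun x =>
      U.factor (hypAssoc m (U.P.h i) b) x * U.P.p i (parentHyp (U.P.h i) b) x)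
    (fun j _ => normDensity μ U.p0 fun x => U.factor j.succ x * U.P.intensity x)

/-- Numbers of local hypotheses after the update. -/
def numHyps : Fin (n + m) → ℕ := Fin.append (fun i => U.P.h i * (m + 1)) (fun _ => 2)

theorem numHyps_castAdd (i : Fin n) : U.numHyps (Fin.castAdd m i) = U.P.h i * (m + 1) :=
  Fin.append_left _ _ i

theorem numHyps_natAdd (j : Fin m) : U.numHyps (Fin.natAdd n j) = 2 :=
  Fin.append_right _ _ j

/-- The unnormalised weight of an updated global hypothesis. -/
def globalWeight (a : Fin n → ℕ) (σ : Fin n → Fin (m + 1)) : ℝ :=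
  U.P.w a * ∏ i, U.localWeight i (updatedHyp U.P.h a σ i)

/-- The normalising constant of the weights of the updated global hypotheses. -/
def totalWeight : ℝ := ∑ a ∈ U.P.hyps, ∑ σ ∈ associations n m, U.globalWeight a σ

theorem localWeight_updatedHyp_castAdd {a : Fin n → ℕ} (ha : a ∈ U.P.hyps)
    (σ : Fin n → Fin (m + 1)) (i : Fin n) :
    U.localWeight (Fin.castAdd m i) (updatedHyp U.P.h a σ (Fin.castAdd m i)) =
      U.weightOld i (a i) (σ i) := by
  rw [updatedHyp_castAdd, localWeight, Fin.append_left, parentHyp_add (U.P.hyps_mem a ha i),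
    hypAssoc_add (U.P.hyps_mem a ha i)]

theorem localWeight_updatedHyp_natAdd (a : Fin n → ℕ) (σ : Fin n → Fin (m + 1)) (j : Fin m) :
    U.localWeight (Fin.natAdd n j) (updatedHyp U.P.h a σ (Fin.natAdd n j)) =
      if j ∈ unassigned σ then U.lamC j + U.newMass j else 1 := by
  rw [updatedHyp_natAdd, localWeight, Fin.append_right]
  split_ifs <;> simp_all

theorem globalWeight_nonneg {a : Fin n → ℕ} (ha : a ∈ U.P.hyps) (σ : Fin n → Fin (m + 1)) :
    0 ≤ U.globalWeight a σ := by
  refine mul_nonneg (U.P.w_nonneg a ha) (Finset.prod_nonneg fun i _ => ?_)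
  induction i using Fin.addCases with
  | left i =>
    rw [U.localWeight_updatedHyp_castAdd ha]
    exact U.weightOld_nonneg (U.P.hyps_mem a ha i) _
  | right j =>
    rw [localWeight_updatedHyp_natAdd]
    split_ifs
    · exact add_nonneg (U.lamC_nonneg j) (U.newMass_nonneg j)
    · exact zero_le_one

theorem exist_mem (i : Fin (n + m)) (b : ℕ) (hb : b ∈ Finset.Icc 1 (U.numHyps i)) :
    0 ≤ U.exist i b ∧ U.exist i b ≤ 1 := by
  induction i using Fin.addCases with
  | left i =>
    rw [numHyps_castAdd] at hb
    rw [exist, Fin.append_left]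
    exact U.existOld_mem (parentHyp_mem hb) _
  | right j =>
    rw [exist, Fin.append_right]
    split_ifs
    · exact ⟨le_rfl, zero_le_one⟩
    · exact div_add_mem (U.lamC_nonneg j) (U.newMass_nonneg j)

theorem isProbDensity_dens (i : Fin (n + m)) (b : ℕ) (hb : b ∈ Finset.Icc 1 (U.numHyps i)) :
    IsProbDensity μ (U.dens i b) := by
  induction i using Fin.addCases with
  | left i =>
    rw [numHyps_castAdd] at hb
    have ha := parentHyp_mem hb
    rw [dens, Fin.append_left]
    exact isProbDensity_normDensity U.isProbDensity_p0
      ((U.factor_measurable _).mul (U.P.isProbDensity _ _ ha).measurable)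
      (U.factor_mul_p_nonneg ha _)
  | right j =>
    rw [dens, Fin.append_right]
    exact isProbDensity_normDensity U.isProbDensity_p0
      ((U.factor_measurable _).mul U.P.isIntensity.measurable)
      (U.factor_mul_intensity_nonneg _)

theorem updatedHyp_mem {a : Fin n → ℕ} (ha : a ∈ U.P.hyps) (σ : Fin n → Fin (m + 1))
    (i : Fin (n + m)) : updatedHyp U.P.h a σ i ∈ Finset.Icc 1 (U.numHyps i) := by
  induction i using Fin.addCases with
  | left i =>
    rw [updatedHyp_castAdd, numHyps_castAdd]
    have h1 := U.P.hyps_mem a ha i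
    rw [Finset.mem_Icc] at h1 ⊢
    have h2 : U.P.h i * (σ i : ℕ) ≤ U.P.h i * m := Nat.mul_le_mul_left _ (Fin.is_le _)
    rw [mul_add]
    omega
  | right j =>
    rw [updatedHyp_natAdd, numHyps_natAdd]
    split_ifs <;> simp

theorem update_misdetected {i : Fin n} {a : ℕ} (ha : a ∈ Finset.Icc 1 (U.P.h i)) :
    U.localWeight (Fin.castAdd m i) a = 1 - U.P.r i a * innerProd μ (U.P.p i a) U.pD ∧
    U.exist (Fin.castAdd m i) a = U.P.r i a * innerProd μ (U.P.p i a) (fun x => 1 - U.pD x) /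
      (1 - U.P.r i a * innerProd μ (U.P.p i a) U.pD) ∧
    (innerProd μ (U.P.p i a) (fun x => 1 - U.pD x) ≠ 0 → ∀ x, U.dens (Fin.castAdd m i) a x =
      (1 - U.pD x) * U.P.p i a x / innerProd μ (U.P.p i a) fun x => 1 - U.pD x) := by
  -- Missed detection is the association `0`: the index `a` is `a + h * 0`.
  have hp : parentHyp (U.P.h i) a = a := by simpa using parentHyp_add ha 0
  have hk : hypAssoc m (U.P.h i) a = 0 := by simpa using hypAssoc_add ha (0 : Fin (m + 1))
  rw [localWeight, exist, dens, Fin.append_left, Fin.append_left, Fin.append_left, hp, hk]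
  refine ⟨rfl, rfl, fun h x => ?_⟩
  rw [innerProd_one_sub_pD] at h ⊢
  exact normDensity_of_ne_zero h x

theorem update_detected {i : Fin n} {a : ℕ} (ha : a ∈ Finset.Icc 1 (U.P.h i)) (j : Fin m) :
    U.exist (Fin.castAdd m i) (a + U.P.h i * ((j : ℕ) + 1)) = 1 ∧
    U.localWeight (Fin.castAdd m i) (a + U.P.h i * ((j : ℕ) + 1)) =
      U.P.r i a * innerProd μ (U.P.p i a) (fun x => U.l j x * U.pD x) ∧
    (innerProd μ (U.P.p i a) (fun x => U.l j x * U.pD x) ≠ 0 →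
      ∀ x, U.dens (Fin.castAdd m i) (a + U.P.h i * ((j : ℕ) + 1)) x =
        U.l j x * U.pD x * U.P.p i a x /
          innerProd μ (U.P.p i a) fun x => U.l j x * U.pD x) := by
  have hp := parentHyp_add ha ((j : ℕ) + 1)
  have hk := hypAssoc_add ha j.succ
  rw [Fin.val_succ] at hk
  rw [localWeight, exist, dens, Fin.append_left, Fin.append_left, Fin.append_left, hp, hk]
  refine ⟨rfl, rfl, fun h x => ?_⟩
  rw [innerProd_l_mul_pD] at h ⊢
  exact normDensity_of_ne_zero h x

theorem update_new (j : Fin m) :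
    U.localWeight (Fin.natAdd n j) 1 = 1 ∧
    U.exist (Fin.natAdd n j) 1 = 0 ∧
    U.localWeight (Fin.natAdd n j) 2 = U.lamC j + U.newMass j ∧
    U.exist (Fin.natAdd n j) 2 = U.newMass j / (U.lamC j + U.newMass j) ∧
    (U.newMass j ≠ 0 → ∀ x, U.dens (Fin.natAdd n j) 2 x =
      U.l j x * U.pD x * U.P.intensity x / U.newMass j) := by
  rw [localWeight, exist, dens, Fin.append_right, Fin.append_right, Fin.append_right]
  refine ⟨if_pos rfl, if_pos rfl, if_neg (by norm_num), if_neg (by norm_num), fun h x => ?_⟩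
  rw [newMass_eq] at h ⊢
  exact normDensity_of_ne_zero h x

/-- The weight of an updated global hypothesis. -/
def weight (b : Fin (n + m) → ℕ) : ℝ :=
  U.P.w (fun i => parentHyp (U.P.h i) (b (Fin.castAdd m i))) *
    (∏ i, U.localWeight i (b i)) / U.totalWeight

theorem weight_updatedHyp {a : Fin n → ℕ} (ha : a ∈ U.P.hyps) (σ : Fin n → Fin (m + 1)) :
    U.weight (updatedHyp U.P.h a σ) = U.globalWeight a σ / U.totalWeight := by
  rw [weight, globalWeight]
  have : (fun i => parentHyp (U.P.h i) (updatedHyp U.P.h a σ (Fin.castAdd m i))) = a := by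
    funext i
    rw [updatedHyp_castAdd, parentHyp_add (U.P.hyps_mem a ha i)]
  rw [this]

/-- The updated global hypotheses. -/
def globalHyps : Finset (Fin (n + m) → ℕ) :=
  (U.P.hyps ×ˢ associations n m).image fun q => updatedHyp U.P.h q.1 q.2

theorem mem_globalHyps {b : Fin (n + m) → ℕ} :
    b ∈ U.globalHyps ↔ ∃ a ∈ U.P.hyps, ∃ σ ∈ associations n m, b = updatedHyp U.P.h a σ := by
  simp only [globalHyps, Finset.mem_image, Finset.mem_product, Prod.exists]
  constructor
  · rintro ⟨a, σ, ⟨ha, hσ⟩, rfl⟩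
    exact ⟨a, ha, σ, hσ, rfl⟩
  · rintro ⟨a, ha, σ, hσ, rfl⟩
    exact ⟨a, σ, ⟨ha, hσ⟩, rfl⟩

theorem sum_globalHyps (F : (Fin (n + m) → ℕ) → ℝ) :
    ∑ b ∈ U.globalHyps, F b =
      ∑ a ∈ U.P.hyps, ∑ σ ∈ associations n m, F (updatedHyp U.P.h a σ) := by
  rw [globalHyps, Finset.sum_image, Finset.sum_product]
  rintro ⟨a, σ⟩ h ⟨a', σ'⟩ h' he
  simp only [Finset.coe_product, Set.mem_prod, Finset.mem_coe] at h h'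
  obtain ⟨rfl, rfl⟩ := updatedHyp_injective (U.P.hyps_mem a h.1) (U.P.hyps_mem a' h'.1) he
  rfl

/-- The updated PMBM density. -/
def posterior (hW : U.totalWeight ≠ 0) : PMBM μ (n + m) where
  intensity x := U.factor 0 x * U.P.intensity x
  h := U.numHyps
  r := U.exist
  p := U.dens
  hyps := U.globalHyps
  w := U.weight
  isIntensity :=
    ⟨(U.factor_measurable 0).mul U.P.isIntensity.measurable, U.factor_mul_intensity_nonneg 0,
      U.integrable_factor_mul_intensity 0⟩
  r_mem := U.exist_mem
  isProbDensity := U.isProbDensity_dens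
  hyps_mem b hb := by
    obtain ⟨a, ha, σ, _, rfl⟩ := U.mem_globalHyps.1 hb
    exact U.updatedHyp_mem ha σ
  w_nonneg b hb := by
    obtain ⟨a, ha, σ, _, rfl⟩ := U.mem_globalHyps.1 hb
    rw [U.weight_updatedHyp ha]
    exact div_nonneg (U.globalWeight_nonneg ha σ) (Finset.sum_nonneg fun a ha =>
      Finset.sum_nonneg fun σ _ => U.globalWeight_nonneg ha σ)
  w_sum := by
    rw [sum_globalHyps, Finset.sum_congr rfl fun a ha => Finset.sum_congr rfl fun σ _ =>
      U.weight_updatedHyp ha σ]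
    simp only [← Finset.sum_div]
    exact div_self hW

/-- The Poisson multi-Bernoulli function of an updated global hypothesis. -/
def component (b : Fin (n + m) → ℕ) : SetAlg S ℝ :=
  poisson (fun x => U.factor 0 x * U.P.intensity x) *
    ∏ i, bern (1 - U.exist i (b i)) fun x => U.exist i (b i) * U.dens i (b i) x

/-- The sums over labelled decompositions are convolution products, and hypothesis weights are
constants `C` of the algebra. -/
theorem density_eq_sum (P : PMBM μ n) (X : Finset S) :
    P.density X = Real.exp (-∫ x, P.intensity x ∂μ) * ∑ a ∈ P.hyps, P.w a *
      (poisson P.intensity * ∏ i, bern (1 - P.r i (a i)) fun x => P.r i (a i) * P.p i (a i) x :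
        SetAlg S ℝ) X := by
  have h : P.mbmDensity = (∑ a ∈ P.hyps, C (P.w a) *
      ∏ i, bern (1 - P.r i (a i)) fun x => P.r i (a i) * P.p i (a i) x : SetAlg S ℝ) := by
    funext X
    rw [SetAlg.sum_apply]
    refine Finset.sum_congr rfl fun a _ => ?_
    rw [C_mul_apply, unionDensity_eq_prod]
    simp only [bernoulliDensity_eq_bern]
  rw [PMBM.density, h, poissonUnionDensity_eq, Finset.mul_sum, SetAlg.sum_apply]
  congr 1
  refine Finset.sum_congr rfl fun a _ => ?_
  rw [mul_left_comm, C_mul_apply]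

theorem posterior_density (hW : U.totalWeight ≠ 0) (X : Finset S) :
    (U.posterior hW).density X = Real.exp (-∫ x, U.factor 0 x * U.P.intensity x ∂μ) /
      U.totalWeight * ∑ a ∈ U.P.hyps, ∑ σ ∈ associations n m,
        U.globalWeight a σ * U.component (updatedHyp U.P.h a σ) X := by
  rw [density_eq_sum]
  change Real.exp (-∫ x, U.factor 0 x * U.P.intensity x ∂μ) *
    ∑ b ∈ U.globalHyps, U.weight b * U.component b X = _
  rw [sum_globalHyps, div_mul_eq_mul_div, mul_div_assoc, Finset.sum_div]
  congr 1
  refine Finset.sum_congr rfl fun a ha => ?_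
  rw [Finset.sum_div]
  refine Finset.sum_congr rfl fun σ _ => ?_
  rw [U.weight_updatedHyp ha]
  ring

/-- The points at which the updated single-object densities are proportional to the products of
likelihoods and predicted densities. -/
def Regular (x : S) : Prop :=
  (∀ i, ∀ a ∈ Finset.Icc 1 (U.P.h i), ∀ k,
    (∫ y, U.factor k y * U.P.p i a y ∂μ) *
      normDensity μ U.p0 (fun y => U.factor k y * U.P.p i a y) x = U.factor k x * U.P.p i a x) ∧
  ∀ j : Fin m, (∫ y, U.factor j.succ y * U.P.intensity y ∂μ) *
    normDensity μ U.p0 (fun y => U.factor j.succ y * U.P.intensity y) x =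
      U.factor j.succ x * U.P.intensity x

theorem ae_regular : ∀ᵐ x ∂μ, U.Regular x := by
  refine Filter.Eventually.and ?_ ?_
  -- The quantifiers over `i`, `a`, `k` are countable, so the exceptional null sets can be united.
  · refine ae_all_iff.2 fun i => ae_all_iff.2 fun a => ?_
    by_cases ha : a ∈ Finset.Icc 1 (U.P.h i)
    · have := ae_all_iff.2 fun k => integral_mul_normDensity (p0 := U.p0)
        (U.integrable_factor_mul_p ha k) (U.factor_mul_p_nonneg ha k)
      filter_upwards [this] with x hx _ using hx
    · exact Filter.Eventually.of_forall fun x h => absurd h ha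
  · exact ae_all_iff.2 fun j => integral_mul_normDensity (U.integrable_factor_mul_intensity _)
      (U.factor_mul_intensity_nonneg _)

/-- Two Bernoulli elements are compared at `∅` and at singletons. Only regular points are available,
hence the restriction to subsets of `X`. -/
theorem C_localWeight_mul_bern_castAdd {a : Fin n → ℕ} (ha : a ∈ U.P.hyps)
    (σ : Fin n → Fin (m + 1)) {X : Finset S} (hX : ∀ x ∈ X, U.Regular x) (i : Fin n) (b : ℕ)
    (hb : b = updatedHyp U.P.h a σ (Fin.castAdd m i)) :
    ∀ Y ⊆ X, (C (U.localWeight (Fin.castAdd m i) b) * bern (1 - U.exist (Fin.castAdd m i) b)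
        (fun x => U.exist (Fin.castAdd m i) b * U.dens (Fin.castAdd m i) b x) : SetAlg S ℝ) Y =
      bern (if σ i = 0 then 1 - U.P.r i (a i) else 0)
        (fun x => U.P.r i (a i) * U.P.p i (a i) x * U.factor (σ i) x) Y := by
  have hai := U.P.hyps_mem a ha i
  rw [C_mul_bern]
  have hp : parentHyp (U.P.h i) b = a i := by
    rw [hb, updatedHyp_castAdd, parentHyp_add hai]
  have hk : hypAssoc m (U.P.h i) b = σ i := by
    rw [hb, updatedHyp_castAdd, hypAssoc_add hai]
  rw [localWeight, exist, dens, Fin.append_left, Fin.append_left, Fin.append_left, hp, hk]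
  refine bern_eq_of ?_ ?_ fun Y h => bern_of_one_lt_card _ _ h
  · rw [bern_empty, U.weightOld_mul_one_sub_existOld hai]
  · intro x hx
    rw [bern_singleton, ← mul_assoc, U.weightOld_mul_existOld hai, mul_assoc,
      (hX x hx).1 i (a i) hai]
    ring

/-- For an assigned measurement the new component has weight `1` and existence `0`, so it is the
unit of the algebra and drops out of the product. -/
theorem C_localWeight_mul_bern_natAdd (a : Fin n → ℕ)
    (σ : Fin n → Fin (m + 1)) {X : Finset S} (hX : ∀ x ∈ X, U.Regular x) (j : Fin m) (b : ℕ)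
    (hb : b = updatedHyp U.P.h a σ (Fin.natAdd n j)) :
    ∀ Y ⊆ X, (C (U.localWeight (Fin.natAdd n j) b) * bern (1 - U.exist (Fin.natAdd n j) b)
        (fun x => U.exist (Fin.natAdd n j) b * U.dens (Fin.natAdd n j) b x) : SetAlg S ℝ) Y =
      (if j ∈ unassigned σ then bern (U.lamC j) fun x => U.P.intensity x * U.factor j.succ x
        else 1 : SetAlg S ℝ) Y := by
  rw [updatedHyp_natAdd] at hb
  rw [C_mul_bern, localWeight, exist, dens, Fin.append_right, Fin.append_right, Fin.append_right]
  have hmul := add_mul_div_add (U.lamC_nonneg j) (U.newMass_nonneg j)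
  by_cases hj : j ∈ unassigned σ
  · rw [if_pos hj] at hb ⊢
    have hb1 : b ≠ 1 := by omega
    rw [if_neg hb1, if_neg hb1]
    refine bern_eq_of ?_ ?_ fun Y h => bern_of_one_lt_card _ _ h
    · rw [bern_empty, mul_sub, hmul]
      ring
    · intro x hx
      rw [bern_singleton, ← mul_assoc, hmul, newMass_eq, (hX x hx).2 j, mul_comm]
  · rw [if_neg hj] at hb ⊢
    rw [if_pos hb, if_pos hb]
    intro Y _
    rw [← map_one C, C_eq_bern]
    simp

/-- The local weights are distributed over the Bernoulli factors, which are then matched one by one.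
-/
theorem globalWeight_mul_component {a : Fin n → ℕ} (ha : a ∈ U.P.hyps)
    (σ : Fin n → Fin (m + 1)) {X : Finset S} (hX : ∀ x ∈ X, U.Regular x) :
    U.globalWeight a σ * U.component (updatedHyp U.P.h a σ) X = U.P.w a *
      (poisson (fun x => U.P.intensity x * U.factor 0 x) *
        (∏ j ∈ unassigned σ, bern (U.lamC j) fun x => U.P.intensity x * U.factor j.succ x) *
        ∏ i, bern (if σ i = 0 then 1 - U.P.r i (a i) else 0)
          fun x => U.P.r i (a i) * U.P.p i (a i) x * U.factor (σ i) x : SetAlg S ℝ) X := by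
  rw [globalWeight, mul_assoc, component, ← C_mul_apply, mul_left_comm, map_prod,
    ← Finset.prod_mul_distrib, Fin.prod_univ_add, mul_assoc (poisson _),
    mul_comm (∏ j ∈ unassigned σ, _)]
  congr 1
  refine mul_congr (fun Y _ => ?_) (mul_congr ?_ ?_) X subset_rfl
  · simp only [mul_comm]
  · exact prod_congr fun i _ => U.C_localWeight_mul_bern_castAdd ha σ hX i _ rfl
  · have hprod : (∏ j ∈ unassigned σ, bern (U.lamC j) fun x =>
          U.P.intensity x * U.factor j.succ x : SetAlg S ℝ) =
        ∏ j, if j ∈ unassigned σ then bern (U.lamC j) fun x =>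
          U.P.intensity x * U.factor j.succ x else 1 := by
      rw [Finset.prod_ite_mem, Finset.univ_inter]
    rw [hprod]
    exact prod_congr fun j _ => U.C_localWeight_mul_bern_natAdd a σ hX j _ rfl

/-- The joint density of the measurements and the objects, up to the clutter void probability. -/
theorem likelihood_mul_density {X : Finset S} (hX : ∀ x ∈ X, U.Regular x) :
    (poisson U.lamC * ∏ x ∈ X, bern (1 - U.pD x) (fun j => U.l j x * U.pD x) :
        SetAlg (Fin m) ℝ) Finset.univ * U.P.density X =
      Real.exp (-∫ x, U.P.intensity x ∂μ) * ∑ a ∈ U.P.hyps, ∑ σ ∈ associations n m,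
        U.globalWeight a σ * U.component (updatedHyp U.P.h a σ) X := by
  rw [density_eq_sum, mul_left_comm, Finset.mul_sum]
  congr 1
  refine Finset.sum_congr rfl fun a ha => ?_
  rw [Finset.sum_congr rfl fun σ _ => U.globalWeight_mul_component ha σ hX, ← Finset.mul_sum,
    mul_left_comm]
  congr 1
  exact likelihood_mul_eq_sum_associations U.lamC U.factor U.P.intensity _ _ X

variable [SigmaFinite μ] [NullSingletonClass μ] [MeasurableEq S]

/-- Each normalised Bernoulli factor has total mass `(1 - r) + r = 1`, so only the Poisson mass
remains, the same for all hypotheses. -/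
theorem setIntegrable_component {a : Fin n → ℕ} (ha : a ∈ U.P.hyps) (σ : Fin n → Fin (m + 1)) :
    SetIntegrable μ (U.component (updatedHyp U.P.h a σ)) ∧
      setIntegral μ (U.component (updatedHyp U.P.h a σ)) =
        Real.exp (∫ x, U.factor 0 x * U.P.intensity x ∂μ) := by
  have hd := fun i => U.isProbDensity_dens i _ (U.updatedHyp_mem ha σ i)
  obtain ⟨h1, h2⟩ := setIntegrable_poisson_mul_prod_bern (μ := μ) Finset.univ
    (U.integrable_factor_mul_intensity 0)
    (fun i => 1 - U.exist i (updatedHyp U.P.h a σ i)) (fun i _ =>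
      (hd i).integrable.const_mul (U.exist i (updatedHyp U.P.h a σ i)))
  refine ⟨h1, h2.trans ?_⟩
  rw [Finset.prod_eq_one, mul_one]
  intro i _
  rw [integral_const_mul, (hd i).integral_eq_one]
  ring

/-- Bayes' rule for a likelihood of the measurement model: the normalising integral converges, and
the posterior is the updated PMBM. -/
theorem bayes {L : Finset S → ℝ} {κ : ℝ} (hL : ∀ X, L X = κ *
      (poisson U.lamC * ∏ x ∈ X, bern (1 - U.pD x) (fun j => U.l j x * U.pD x) :
        SetAlg (Fin m) ℝ) Finset.univ)
    (hpos : setIntegral μ (fun X => L X * U.P.density X) ≠ 0) :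
    SetIntegrable μ (fun X => L X * U.P.density X) ∧
      ∃ hW : U.totalWeight ≠ 0,
        DensityEq μ (bayesPosterior μ L U.P.density) (U.posterior hW).density := by
  set K := κ * Real.exp (-∫ x, U.P.intensity x ∂μ) with hK
  set G : Finset S → ℝ := fun X => ∑ a ∈ U.P.hyps, ∑ σ ∈ associations n m,
        U.globalWeight a σ * U.component (updatedHyp U.P.h a σ) X with hG
  have hjoint : ∀ X : Finset S, (∀ x ∈ X, U.Regular x) → K * G X = L X * U.P.density X := by
    intro X hX
    rw [hL, hK, mul_assoc κ, mul_assoc κ]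
    exact congrArg (κ * ·) (U.likelihood_mul_density hX).symm
  have heq : DensityEq μ (fun X => K * G X) (fun X => L X * U.P.density X) :=
    densityEq_of_ae U.ae_regular hjoint
  have hc : ∀ a ∈ U.P.hyps, ∀ σ ∈ associations n m, SetIntegrable μ fun X =>
      U.globalWeight a σ * U.component (updatedHyp U.P.h a σ) X := fun a ha σ _ =>
    (U.setIntegrable_component ha σ).1.const_mul _
  have hGi : SetIntegrable μ G :=
    SetIntegrable.sum fun a ha => SetIntegrable.sum (hc a ha)
  have hGs : setIntegral μ G =
      U.totalWeight * Real.exp (∫ x, U.factor 0 x * U.P.intensity x ∂μ) := by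
    rw [hG, setIntegral_sum fun a ha => SetIntegrable.sum (hc a ha), totalWeight, Finset.sum_mul]
    refine Finset.sum_congr rfl fun a ha => ?_
    rw [setIntegral_sum (hc a ha), Finset.sum_mul]
    refine Finset.sum_congr rfl fun σ _ => ?_
    exact (setIntegral_const_mul _ _).trans
      (congrArg (U.globalWeight a σ * ·) (U.setIntegrable_component ha σ).2)
  have hint : setIntegral μ (fun X => L X * U.P.density X) =
      K * (U.totalWeight * Real.exp (∫ x, U.factor 0 x * U.P.intensity x ∂μ)) := by
    rw [← setIntegral_congr heq, setIntegral_const_mul, hGs]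
  -- The normalising constant is a product containing the total weight, so its nonvanishing makes
  -- the updated weights well defined.
  have hne := hpos
  rw [hint] at hne
  have hK0 : K ≠ 0 := left_ne_zero_of_mul hne
  have hW : U.totalWeight ≠ 0 := left_ne_zero_of_mul (right_ne_zero_of_mul hne)
  refine ⟨(hGi.const_mul K).congr heq, hW, densityEq_of_ae U.ae_regular fun X hX => ?_⟩
  rw [bayesPosterior, hint, ← hjoint X hX, posterior_density, Real.exp_neg]
  have := Real.exp_ne_zero (∫ x, U.factor 0 x * U.P.intensity x ∂μ)
  field_simp
  rfl

end PMBMUpdate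

end UpdateTheory

/-! ### Two-step trajectories -/

section Trajectories

theorem measurableEmbedding_inl {α β : Type*} [MeasurableSpace α] [MeasurableSpace β] :
    MeasurableEmbedding (Sum.inl : α → α ⊕ β) :=
  ⟨Sum.inl_injective, measurable_inl, fun _ hs => hs.inl_image⟩

theorem measurableEmbedding_inr {α β : Type*} [MeasurableSpace α] [MeasurableSpace β] :
    MeasurableEmbedding (Sum.inr : β → α ⊕ β) :=
  ⟨Sum.inr_injective, measurable_inr, fun _ hs => measurableSet_inr_image.2 hs⟩

/-- The diagonal of a sum is the union of the embedded diagonals; its measurability is needed for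
the coincidence sets in `ae_injective`. -/
theorem measurableEq_sum {α β : Type*} [MeasurableSpace α] [MeasurableSpace β]
    [MeasurableEq α] [MeasurableEq β] :
    MeasurableEq (α ⊕ β) := by
  constructor
  have h : Set.diagonal (α ⊕ β) =
      (Prod.map Sum.inl Sum.inl '' Set.diagonal α) ∪
        (Prod.map Sum.inr Sum.inr '' Set.diagonal β) := by
    ext ⟨x, y⟩
    rcases x with x | x <;> rcases y with y | y <;> simp
  rw [h]
  exact ((measurableEmbedding_inl.prodMap measurableEmbedding_inl).measurableSet_image.2
    measurableSet_diagonal).union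
    ((measurableEmbedding_inr.prodMap measurableEmbedding_inr).measurableSet_image.2
      measurableSet_diagonal)

variable {d : ℕ}

instance : MeasurableEq (TwoStep d) := by
  have h := measurableEq_sum (α := Fin d → ℝ) (β := (Fin d → ℝ) × (Fin d → ℝ))
  exact measurableEq_sum (α := Fin d → ℝ)

instance : SigmaFinite (trajMeasure d) := by
  have h1 : SigmaFinite (Measure.map (fun x : Fin d → ℝ => (Sum.inl x : TwoStep d)) volume) :=
    measurableEmbedding_inl.sigmaFinite_map
  have h2 : SigmaFinite
      (Measure.map (fun x : Fin d → ℝ => (Sum.inr (Sum.inl x) : TwoStep d)) volume) :=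
    (measurableEmbedding_inr.comp measurableEmbedding_inl).sigmaFinite_map
  have h3 : SigmaFinite (Measure.map
      (fun x : (Fin d → ℝ) × (Fin d → ℝ) => (Sum.inr (Sum.inr x) : TwoStep d)) volume) :=
    (measurableEmbedding_inr.comp measurableEmbedding_inr).sigmaFinite_map
  unfold trajMeasure
  infer_instance

theorem trajMeasure_apply {s : Set (TwoStep d)} (hs : MeasurableSet s) :
    trajMeasure d s = volume {x | (Sum.inl x : TwoStep d) ∈ s} +
      volume {x | (Sum.inr (Sum.inl x) : TwoStep d) ∈ s} +
      volume {x | (Sum.inr (Sum.inr x) : TwoStep d) ∈ s} := by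
  rw [trajMeasure, Measure.add_apply, Measure.add_apply, Measure.map_apply measurable_inl hs,
    Measure.map_apply (by fun_prop) hs, Measure.map_apply (by fun_prop) hs]
  rfl

/-- Positive dimension matters: in dimension zero each piece is a single point of mass one. -/
theorem nullSingletonClass_trajMeasure (hd : 0 < d) : NullSingletonClass (trajMeasure d) := by
  have : Nonempty (Fin d) := ⟨⟨0, hd⟩⟩
  have : NullSingletonClass (volume : Measure ((Fin d → ℝ) × (Fin d → ℝ))) :=
    Measure.prod.instNullSingletonClass_fst
  constructor
  intro x
  rw [trajMeasure_apply (measurableSet_singleton x)]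
  rcases x with x | x | x <;> simp

/-- The indicator of the unit cube in the first piece; it serves as the arbitrary density of
hypotheses with zero denominator. -/
theorem exists_isProbDensity_trajMeasure : ∃ p, IsProbDensity (trajMeasure d) p := by
  set s : Set (TwoStep d) := Sum.inl '' Set.Icc (0 : Fin d → ℝ) 1 with hs
  have hsm : MeasurableSet s := measurableSet_Icc.inl_image
  have hvol : trajMeasure d s = 1 := by
    rw [trajMeasure_apply hsm]
    have h1 : {x | (Sum.inl x : TwoStep d) ∈ s} = Set.Icc (0 : Fin d → ℝ) 1 := by
      ext x
      simp [hs]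
    have h2 : {x | (Sum.inr (Sum.inl x) : TwoStep d) ∈ s} = ∅ := by
      ext x
      simp [hs]
    have h3 : {x | (Sum.inr (Sum.inr x) : TwoStep d) ∈ s} = ∅ := by
      ext x
      simp [hs]
    rw [h1, h2, h3, Real.volume_Icc_pi]
    simp
  refine ⟨s.indicator 1, measurable_one.indicator hsm,
    fun x => Set.indicator_nonneg (fun _ _ => zero_le_one) x, ?_⟩
  rw [integral_indicator_one hsm, measureReal_def, hvol, ENNReal.toReal_one]

namespace TrajMeasModel

variable {nx nz : ℕ} (M : TrajMeasModel nx nz)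

theorem gam_nonneg : 0 ≤ M.gam := by
  have := M.pFull_mem.2
  unfold gam
  linarith

theorem l_nonneg (Z : TwoStep nz) (X : TwoStep nx) : 0 ≤ M.l Z X := by
  rcases Z with z | z | z <;> rcases X with x | x | x <;> simp only [l, le_refl]
  · exact M.h11_density.nonneg z x
  · exact mul_nonneg M.gam_nonneg (M.h13_density.nonneg z x)
  · exact M.h22_density.nonneg z x
  · exact mul_nonneg M.gam_nonneg (M.h23_density.nonneg z x)
  · exact mul_nonneg M.pFull_mem.1 (M.h33_density.nonneg z x)

theorem l_measurable (Z : TwoStep nz) : Measurable (M.l Z) := by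
  have sect : ∀ {A B : Type} [MeasureSpace A] [MeasurableSpace B] {h : A → B → ℝ},
      IsCondDensity h → ∀ z, Measurable (h z) := fun hh z =>
    hh.measurable.comp measurable_prodMk_left
  rcases Z with z | z | z <;>
    refine measurable_fun_sum ?_ (measurable_fun_sum ?_ ?_)
  · exact sect M.h11_density z
  · exact measurable_const
  · exact (sect M.h13_density z).const_mul _
  · exact measurable_const
  · exact sect M.h22_density z
  · exact (sect M.h23_density z).const_mul _
  · exact measurable_const
  · exact measurable_const
  · exact (sect M.h33_density z).const_mul _

open SetAlg in
-- Since the measurements are distinct, evaluation at `{Z 1, …, Z m}` is restriction along the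
-- embedding `Z` followed by evaluation at `univ`, and restriction is a ring homomorphism.
theorem likelihood_eq {m : ℕ} {Z : Fin m → TwoStep nz} (hZ : Function.Injective Z)
    (X : Finset (TwoStep nx)) : M.likelihood (toFiniteSet Z) X =
      Real.exp (-∫ z, M.lamC z ∂(trajMeasure nz)) *
        (poisson (fun j => M.lamC (Z j)) *
          ∏ x ∈ X, bern (1 - M.pD x) (fun j => M.l (Z j) x * M.pD x) :
          SetAlg (Fin m) ℝ) Finset.univ := by
  have h : (poisson (fun j => M.lamC (Z j)) *
      ∏ x ∈ X, bern (1 - M.pD x) (fun j => M.l (Z j) x * M.pD x) : SetAlg (Fin m) ℝ) =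
      comap ⟨Z, hZ⟩ (poisson M.lamC *
        ∏ x ∈ X, bern (1 - M.pD x) fun z => M.pD x * M.l z x) := by
    rw [map_mul, map_prod, comap_poisson]
    simp only [comap_bern, Function.Embedding.coeFn_mk, mul_comm]
  rw [h, comap_apply, ← toFiniteSet_eq_map hZ, likelihood, unionDensity_eq_prod,
    ← Finset.prod_coe_sort]
  simp only [bernoulliDensity_eq_bern]
  exact poissonUnionDensity_eq _ _ _ _

end TrajMeasModel

end Trajectories
end

/-! ### The update for two-step trajectories -/

theorem lemma2 {nx nz n m : ℕ} (hnx : 0 < nx)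
    (M : TrajMeasModel nx nz)
    -- predicted PMBM density
    (P : PMBM (trajMeasure nx) n)
    -- the set `{Z 1, …, Z m}` of trajectory measurements
    (Z : Fin m → TwoStep nz) (hZ : Function.Injective Z)
    -- the inner products that appear in the update are finite
    (hintP : ∀ i, ∀ a ∈ Finset.Icc 1 (P.h i), ∀ j,
      Integrable (fun X => P.p i a X * (M.l (Z j) X * M.pD X)) (trajMeasure nx))
    (hintL : ∀ j,
      Integrable (fun X => P.intensity X * (M.l (Z j) X * M.pD X)) (trajMeasure nx))
    -- the predicted density of the measurement set does not vanish
    (hpos : setIntegral (trajMeasure nx)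
      (fun X => M.likelihood (toFiniteSet Z) X * P.density X) ≠ 0) :
    -- the normalising integral of Bayes' rule converges, and the posterior is a PMBM
    SetIntegrable (trajMeasure nx)
      (fun X => M.likelihood (toFiniteSet Z) X * P.density X) ∧
    ∃ (Q : PMBM (trajMeasure nx) (n + m)) (wl : Fin (n + m) → ℕ → ℝ),
      DensityEq (trajMeasure nx)
        (bayesPosterior (trajMeasure nx) (M.likelihood (toFiniteSet Z)) P.density) Q.density ∧
      -- Poisson intensity
      (∀ X, Q.intensity X = (1 - M.pD X) * P.intensity X) ∧
      -- numbers of local hypotheses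
      (∀ i : Fin n, Q.h (Fin.castAdd m i) = P.h i * (m + 1)) ∧
      (∀ j : Fin m, Q.h (Fin.natAdd n j) = 2) ∧
      -- missed detection of an existing component
      (∀ i : Fin n, ∀ a ∈ Finset.Icc 1 (P.h i),
        wl (Fin.castAdd m i) a = 1 - P.r i a * innerProd (trajMeasure nx) (P.p i a) M.pD ∧
        Q.r (Fin.castAdd m i) a =
          P.r i a * innerProd (trajMeasure nx) (P.p i a) (fun X => 1 - M.pD X) /
            (1 - P.r i a * innerProd (trajMeasure nx) (P.p i a) M.pD) ∧
        (innerProd (trajMeasure nx) (P.p i a) (fun X => 1 - M.pD X) ≠ 0 →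
          ∀ X, Q.p (Fin.castAdd m i) a X =
            (1 - M.pD X) * P.p i a X /
              innerProd (trajMeasure nx) (P.p i a) (fun X => 1 - M.pD X))) ∧
      -- detection of an existing component
      (∀ i : Fin n, ∀ a ∈ Finset.Icc 1 (P.h i), ∀ j : Fin m,
        Q.r (Fin.castAdd m i) (a + P.h i * ((j : ℕ) + 1)) = 1 ∧
        wl (Fin.castAdd m i) (a + P.h i * ((j : ℕ) + 1)) =
          P.r i a * innerProd (trajMeasure nx) (P.p i a) (fun X => M.l (Z j) X * M.pD X) ∧
        (innerProd (trajMeasure nx) (P.p i a) (fun X => M.l (Z j) X * M.pD X) ≠ 0 →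
          ∀ X, Q.p (Fin.castAdd m i) (a + P.h i * ((j : ℕ) + 1)) X =
            M.l (Z j) X * M.pD X * P.p i a X /
              innerProd (trajMeasure nx) (P.p i a) (fun X => M.l (Z j) X * M.pD X))) ∧
      -- new components
      (∀ j : Fin m,
        wl (Fin.natAdd n j) 1 = 1 ∧
        Q.r (Fin.natAdd n j) 1 = 0 ∧
        wl (Fin.natAdd n j) 2 = M.lamC (Z j) +
          innerProd (trajMeasure nx) P.intensity (fun X => M.l (Z j) X * M.pD X) ∧
        Q.r (Fin.natAdd n j) 2 =
          innerProd (trajMeasure nx) P.intensity (fun X => M.l (Z j) X * M.pD X) /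
            (M.lamC (Z j) +
              innerProd (trajMeasure nx) P.intensity (fun X => M.l (Z j) X * M.pD X)) ∧
        (innerProd (trajMeasure nx) P.intensity (fun X => M.l (Z j) X * M.pD X) ≠ 0 →
          ∀ X, Q.p (Fin.natAdd n j) 2 X =
            M.l (Z j) X * M.pD X * P.intensity X /
              innerProd (trajMeasure nx) P.intensity (fun X => M.l (Z j) X * M.pD X))) ∧
      -- global hypotheses and their weights
      (∀ b, b ∈ Q.hyps ↔ ∃ a ∈ P.hyps, ∃ σ ∈ associations n m, b = updatedHyp P.h a σ) ∧
      (∀ a ∈ P.hyps, ∀ σ ∈ associations n m,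
        Q.w (updatedHyp P.h a σ) =
          P.w a * (∏ i, wl i (updatedHyp P.h a σ i)) /
            ∑ a' ∈ P.hyps, ∑ σ' ∈ associations n m,
              P.w a' * ∏ i, wl i (updatedHyp P.h a' σ' i)) := by
  have := nullSingletonClass_trajMeasure hnx
  obtain ⟨p0, hp0⟩ := exists_isProbDensity_trajMeasure (d := nx)
  let U : PMBMUpdate (trajMeasure nx) n m :=
    { P := P
      pD := M.pD
      l := fun j => M.l (Z j)
      lamC := fun j => M.lamC (Z j)
      p0 := p0
      pD_measurable := M.pD_measurable
      pD_nonneg := fun x => (M.pD_mem x).1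
      pD_le_one := fun x => (M.pD_mem x).2
      l_measurable := fun j => M.l_measurable (Z j)
      l_nonneg := fun j => M.l_nonneg (Z j)
      lamC_nonneg := fun j => M.lamC_intensity.nonneg (Z j)
      isProbDensity_p0 := hp0
      integrable_p := hintP
      integrable_intensity := hintL }
  -- The constant `κ` is the void probability `exp (-∫ λ^C)` of the clutter, which cancels in Bayes'
  -- rule.
  obtain ⟨hint, hW, hpost⟩ := U.bayes (M.likelihood_eq hZ) hpos
  refine ⟨hint, U.posterior hW, U.localWeight, hpost, fun X => rfl, fun i => ?_, fun j => ?_,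
    fun i a ha => ?_, fun i a ha j => ?_, fun j => ?_, fun b => U.mem_globalHyps,
    fun a ha σ _ => U.weight_updatedHyp ha σ⟩
  · exact U.numHyps_castAdd i
  · exact U.numHyps_natAdd j
  · obtain ⟨h1, h2, h3⟩ := U.update_misdetected ha
    exact ⟨h1, h2, h3⟩
  · obtain ⟨h1, h2, h3⟩ := U.update_detected ha j
    exact ⟨h1, h2, h3⟩
  · obtain ⟨h1, h2, h3, h4, h5⟩ := U.update_new j
    exact ⟨h1, h2, h3, h4, h5⟩
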